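/- Let $m\in\mathbb N$ and let $X_1,\dots,X_m$ be random variables with values in a common measurable space $\mathcal X$ carrying a $\sigma$-finite reference measure $\nu$. A DAG on $[m]$ is a directed acyclic graph $G$ with vertex set $[m]$; $\pi_i(G)$ is the parent set of node $i$, and $[G]$ is the set of all DAGs on $[m]$ that are Markov equivalent to $G$, i.e. that entail the same conditional independences $X_A\perp X_B\mid X_C$ (d-separation) for all pairwise disjoint $A,B,C\subset[m]$. Let $\mathcal G$ be a nonempty ensemble of DAGs on $[m]$ and let $\mathcal P$ be a nonempty measurable space of parameter maps $\Theta$. For each $G\in\mathcal G$ and $\Theta\in\mathcal P$ the Bayesian network $(G,\Theta)$ has joint density $\prod_{i=1}^m P_i(x_i;\pi_i(G),\Theta)$ with respect to $\nu^{\otimes m}$, where $P_i(\cdot\,;\pi_i(G),\Theta)$ is the conditional density of $X_i$ given $X_{\pi_i(G)}$, measurable in all arguments, and every node $i$ without parents in $G$ has the density $Q_{0,i}=P_i(\cdot\,;\varnothing,\Theta)$, which does not depend on $G$. Let $G$ be uniform on $\mathcal G$, let $\Theta\sim P_{\mathcal P}$ be independent of $G$, and given $(G,\Theta)$ let $S$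 be a data set of $n$ i.i.d. observations of $(X_1,\dots,X_m)$ from the Bayesian network $(G,\Theta)$. Define $$p_{\rm err}=\inf_{\varphi}\ \sup_{P_{\mathcal P}}\ \sum_{G\in\mathcal G}\int \frac1{|\mathcal G|}\,\Pr\{\varphi(S)\notin[G]\mid G,\Theta\}\,dP_{\mathcal P}(\Theta),$$ where the infimum is over all (measurable) decoders $\varphi:(\mathcal X^m)^n\to\mathcal G$ and the supremum over all probability measures on $\mathcal P$. Let $\Delta_{\max}>0$ and assume that for all $G\in\mathcal G$ and $i\in[m]$, $$\sup_{\Theta\in\mathcal P}\ \mathbb E_{X_{\pi_i(G)}}\big[\mathrm{KL}\big(P_i(\cdot\,;\pi_i(G),\Theta)\,\big\|\,Q_{0,i}\big)\big]\le\Delta_{\max},$$ or, alternatively, that all these conditional distributions belong to one exponential family with densities $\exp(\langle\eta,T(x)\rangle-\psi(\eta))h(x)$, $T$ being integrable under each of them, and that for all $G\in\mathcal G$ and $i\in[m]$, $\sup_{\Theta}\mathbb E_{X_{\pi_i(G)}}[\langle\eta_i-\eta_{0,i},\ \mathbb E_{\eta_i}T-\mathbb E_{\eta_{0,i}}T\rangle]\le\Delta_{\max}$,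 where $\eta_i$ and $\eta_{0,i}$ are the natural parameters of $P_i(\cdot\,;\pi_i(G),\Theta)$ and $Q_{0,i}$. If $n\le L(\mathcal G)$, then $p_{\rm err}\ge 1/2$, in each of the following cases. 1. $\mathcal G$ is the set of all DAGs $G$ on $[m]$ with $|[G]|=1$ (essential DAGs), and $$L(\mathcal G)=\frac{\log 2}{2\Delta_{\max}}\Big(\frac{m-3}2-\frac1m\Big).$$ 2. $1<k<m$, $\mathcal G$ is the set of all DAGs $G$ on $[m]$ with $|[G]|=1$ in which every node has at most $k$ parents, and $$L(\mathcal G)=\frac1{2m\Delta_{\max}}\Big(k\big\{\log (m-2)!-\log k!-(m-k-2)\log k\big\}+\Big\{\frac{k(k-3)}2-1\Big\}\log 2\Big).$$ 3. $[m]=V_1\sqcup\dots\sqcup V_l$ is a partition into $l\ge2$ nonempty layers, $m_i=|V_i|$, $\mathcal G$ is the set of all DAGs on $[m]$ in which every edge goes from $V_{i+1}$ to $V_i$ for some $i\in[l-1]$, and $$L(\mathcal G)=\frac{\log 2}{2(m-m_l)\Delta_{\max}}\Big(\sum_{i=1}^{l-1}m_{i+1}m_i-2\Big).$$ 4. With layers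 as in 3 and $k\ge1$, $\mathcal G$ is the set of all DAGs as in 3 in which every node has at most $k$ parents, and $$L(\mathcal G)=\frac{k\sum_{i=1}^{l-1}m_i\log(m_{i+1}/k)-2\log 2}{2(m-m_l)\Delta_{\max}}.$$ -/

import Mathlib

open MeasureTheory
open scoped ENNReal NNReal Nat

noncomputable section

namespace BN

/-- A directed acyclic graph on the vertex set `[m]`; `G.Adj u v` is the edge `u → v`. -/
structure DAG (m : ℕ) extends Digraph (Fin m) where
  acyclic : ∀ v, ¬ Relation.TransGen Adj v v

theorem DAG.toDigraph_injective (m : ℕ) :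
    Function.Injective (DAG.toDigraph : DAG m → Digraph (Fin m)) := by
  rintro ⟨G, hG⟩ ⟨H, hH⟩ h
  cases h
  rfl

instance DAG.instFinite (m : ℕ) : Finite (DAG m) := by
  have h : Function.Injective (fun G : DAG m => G.Adj) := by
    intro G H hGH
    exact DAG.toDigraph_injective m (Digraph.ext hGH)
  exact Finite.of_injective _ h

instance ensembleFintype {m : ℕ} (Gs : Set (DAG m)) : Fintype Gs := Fintype.ofFinite Gs

namespace DAG

variable {m : ℕ}

/-- The parent set `π_i(G)`. -/
def parents (G : DAG m) (i : Fin m) : Set (Fin m) := {j | G.Adj j i}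

/-- The underlying undirected graph. -/
def skeleton (G : DAG m) : SimpleGraph (Fin m) := SimpleGraph.fromRel G.Adj

/-- `v` is a (reflexive) descendant of `u`. -/
def IsDescendant (G : DAG m) (u v : Fin m) : Prop := Relation.ReflTransGen G.Adj u v

/-- A path of the skeleton is active given `C` if each of its interior vertices which is a
collider on the path has a descendant (possibly itself) in `C`, and each of its other interior
vertices is outside `C`. -/
def IsActive (G : DAG m) (C : Set (Fin m)) {a b : Fin m} (p : G.skeleton.Walk a b) : Prop :=
  p.IsPath ∧ ∀ i, 0 < i → i < p.length →
    let IsCollider := G.Adj (p.getVert (i - 1)) (p.getVert i) ∧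
      G.Adj (p.getVert (i + 1)) (p.getVert i)
    (IsCollider → ∃ c ∈ C, G.IsDescendant (p.getVert i) c) ∧
    (¬ IsCollider → p.getVert i ∉ C)

/-- The conditional independence `X_A ⊥ X_B | X_C` asserted by `G` (d-separation). -/
def Indep (G : DAG m) (A B C : Set (Fin m)) : Prop :=
  ∀ a ∈ A, ∀ b ∈ B, ∀ p : G.skeleton.Walk a b, ¬ G.IsActive C p

/-- Markov equivalence: the two graphs assert the same conditional independences. -/
def MarkovEquiv (G H : DAG m) : Prop :=
  ∀ A B C : Set (Fin m), Disjoint A B → Disjoint A C → Disjoint B C →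
    (G.Indep A B C ↔ H.Indep A B C)

/-- The Markov equivalence class `[G]`. -/
def markovClass (G : DAG m) : Set (DAG m) := {H | G.MarkovEquiv H}

/-- Every node has at most `k` parents. -/
def IsSparse (G : DAG m) (k : ℕ) : Prop := ∀ i, (G.parents i).ncard ≤ k

end DAG

/-! ### The ensembles -/

/-- DAGs over `m` nodes whose Markov equivalence class has size one. -/
def essentialDAGs (m : ℕ) : Set (DAG m) := {G | G.markovClass.ncard = 1}

/-- DAGs over `m` nodes whose Markov equivalence class has size one and in which every node has
at most `k` parents. -/
def sparseEssentialDAGs (m k : ℕ) : Set (DAG m) := {G | G ∈ essentialDAGs m ∧ G.IsSparse k}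

/-- Layered DAGs: nodes are assigned to the layers `0, …, l - 1` by `lay`, and every edge goes
from a layer to the one with the preceding index. -/
def layeredDAGs {m l : ℕ} (lay : Fin m → Fin l) : Set (DAG m) :=
  {G | ∀ u v, G.Adj u v → (lay u : ℕ) = (lay v : ℕ) + 1}

/-- Layered DAGs in which every node has at most `k` parents. -/
def sparseLayeredDAGs {m l : ℕ} (lay : Fin m → Fin l) (k : ℕ) : Set (DAG m) :=
  {G | G ∈ layeredDAGs lay ∧ G.IsSparse k}

/-- Number of nodes in the layer with index `j`. -/
def layerSize {m l : ℕ} (lay : Fin m → Fin l) (j : ℕ) : ℕ :=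
  {v : Fin m | (lay v : ℕ) = j}.ncard

/-! ### Parametrized Bayesian networks over an ensemble -/

variable {X : Type*} [MeasurableSpace X] {Θ : Type*} [MeasurableSpace Θ] {m : ℕ}

/-- The Bayesian networks `(G, P(G, θ(G)))`, where `G` ranges over the ensemble `Gs` and `θ` over a
set `Θ` of parameter maps. All conditional distributions are given by densities with respect to a
measure `ν` on the common range `X` of the variables. -/
structure Family (ν : Measure X) (Θ : Type*) [MeasurableSpace Θ] (Gs : Set (DAG m)) where
  /-- the conditional density of node `i` given the values of its parents in `G`, under `θ(G)` -/
  dens : Θ → (G : Gs) → (i : Fin m) → (G.1.parents i → X) → X → ℝ≥0∞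
  /-- the density of node `i` when it has no parents -/
  dens₀ : Θ → Fin m → X → ℝ≥0∞
  measurable_dens : ∀ G i,
    Measurable fun p : Θ × (G.1.parents i → X) × X => dens p.1 G i p.2.1 p.2.2
  measurable_dens₀ : ∀ i, Measurable fun p : Θ × X => dens₀ p.1 i p.2
  lintegral_dens : ∀ θ G i z, ∫⁻ y, dens θ G i z y ∂ν = 1
  lintegral_dens₀ : ∀ θ i, ∫⁻ y, dens₀ θ i y ∂ν = 1
  dens_of_parents_eq_empty : ∀ θ G i, G.1.parents i = ∅ → ∀ z, dens θ G i z = dens₀ θ i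

namespace Family

variable {ν : Measure X} {Gs : Set (DAG m)}

/-- The conditional distribution `P_i(π_i(G), θ)` of node `i`, given that its parents take their
values in the assignment `x`. -/
def cond (M : Family ν Θ Gs) (θ : Θ) (G : Gs) (i : Fin m) (x : Fin m → X) : Measure X :=
  ν.withDensity (M.dens θ G i fun j => x j)

/-- The distribution `P_i(∅, θ)` of node `i` when it has no parents. -/
def cond₀ (M : Family ν Θ Gs) (θ : Θ) (i : Fin m) : Measure X :=
  ν.withDensity (M.dens₀ θ i)

/-- The joint distribution `P(x; G, θ) = ∏ i, P_i(x_i; π_i(G), θ)` of the `m` variables. -/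
def joint (M : Family ν Θ Gs) (θ : Θ) (G : Gs) : Measure (Fin m → X) :=
  (Measure.pi fun _ => ν).withDensity fun x => ∏ i, M.dens θ G i (fun j => x j) (x i)

/-- The distribution of a data set of `n` i.i.d. observations. -/
def data (M : Family ν Θ Gs) (n : ℕ) (θ : Θ) (G : Gs) : Measure (Fin n → Fin m → X) :=
  Measure.pi fun _ => M.joint θ G

/-- The expected KL divergence between the conditional distribution of every node given its
parents and its distribution without parents is at most `Δmax`, for all parameters. -/
def KLBounded (M : Family ν Θ Gs) (Δmax : ℝ) : Prop :=
  ∀ (G : Gs) (i : Fin m) (θ : Θ),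
    ∫⁻ x, InformationTheory.klDiv (M.cond θ G i x) (M.cond₀ θ i) ∂(M.joint θ G)
      ≤ ENNReal.ofReal Δmax

/-- The form of the bound for exponential families: all conditionals have densities
`exp (⟪η, T y⟫ - ψ η) h y`, the sufficient statistic `T` has an expectation under each of them, and
`Δ(η_i, η₀) = ⟪η_i - η₀, E_{η_i} T - E_{η₀} T⟫` has expectation at most `Δmax`. -/
def ExpFamilyBounded (M : Family ν Θ Gs) (Δmax : ℝ) : Prop :=
  ∃ (d : ℕ) (T : X → EuclideanSpace ℝ (Fin d)) (h : X → ℝ≥0)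
    (ψ : EuclideanSpace ℝ (Fin d) → ℝ)
    (η : Θ → (G : Gs) → (i : Fin m) → (G.1.parents i → X) → EuclideanSpace ℝ (Fin d))
    (η₀ : Θ → Fin m → EuclideanSpace ℝ (Fin d)),
    Measurable T ∧ Measurable h ∧
    (∀ θ G i z y, M.dens θ G i z y =
      ENNReal.ofReal (Real.exp (inner ℝ (η θ G i z) (T y) - ψ (η θ G i z)) * h y)) ∧
    (∀ θ i y, M.dens₀ θ i y =
      ENNReal.ofReal (Real.exp (inner ℝ (η₀ θ i) (T y) - ψ (η₀ θ i)) * h y)) ∧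
    (∀ θ G i x, Integrable T (M.cond θ G i x)) ∧
    (∀ θ i, Integrable T (M.cond₀ θ i)) ∧
    ∀ (G : Gs) (i : Fin m) (θ : Θ),
      ∫⁻ x, ENNReal.ofReal (inner ℝ (η θ G i (fun j => x j) - η₀ θ i)
          ((∫ y, T y ∂(M.cond θ G i x)) - ∫ y, T y ∂(M.cond₀ θ i))) ∂(M.joint θ G)
        ≤ ENNReal.ofReal Δmax

/-- The estimation error for `G` uniform on `Gs`: the infimum over all decoders
of the supremum over all distributions `P` of the parameter map `θ`, drawn independently of `G`,
of the probability that the decoded graph is outside `[G]`. -/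
def err (M : Family ν Θ Gs) (n : ℕ) : ℝ≥0∞ :=
  ⨅ (Dec : (Fin n → Fin m → X) → Gs) (_ : ∀ G, MeasurableSet (Dec ⁻¹' {G})),
    ⨆ (P : Measure Θ) (_ : IsProbabilityMeasure P),
      ∑ G : Gs, ∫⁻ θ, (Fintype.card Gs : ℝ≥0∞)⁻¹ *
        M.data n θ G {S | (Dec S).1 ∉ G.1.markovClass} ∂P

end Family

/-! ### The thresholds -/

/-- Threshold for essential DAGs. -/
def thresholdEssential (m : ℕ) (Δmax : ℝ) : ℝ :=
  Real.log 2 / (2 * Δmax) * (((m : ℝ) - 3) / 2 - 1 / m)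

/-- Threshold for essential DAGs with at most `k` parents per node. -/
def thresholdSparseEssential (m k : ℕ) (Δmax : ℝ) : ℝ :=
  1 / (2 * m * Δmax) *
    (k * (Real.log ((m - 2)! : ℕ) - Real.log (k ! : ℕ) - ((m : ℝ) - k - 2) * Real.log k)
      + ((k : ℝ) * (k - 3) / 2 - 1) * Real.log 2)

/-- Threshold for layered DAGs. -/
def thresholdLayered {m l : ℕ} (lay : Fin m → Fin l) (Δmax : ℝ) : ℝ :=
  Real.log 2 / (2 * ((m : ℝ) - layerSize lay (l - 1)) * Δmax) *
    ((∑ j ∈ Finset.range (l - 1), (layerSize lay (j + 1) : ℝ) * layerSize lay j) - 2)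

/-- Threshold for layered DAGs with at most `k` parents per node. -/
def thresholdSparseLayered {m l : ℕ} (lay : Fin m → Fin l) (k : ℕ) (Δmax : ℝ) : ℝ :=
  (k * (∑ j ∈ Finset.range (l - 1),
      (layerSize lay j : ℝ) * Real.log ((layerSize lay (j + 1) : ℝ) / k)) - 2 * Real.log 2) /
    (2 * ((m : ℝ) - layerSize lay (l - 1)) * Δmax)

end BN

end

/-! The proof is Fano's method with a product measure as reference. Fix one parameter `θ` and let
the prior be its Dirac mass. Markov equivalent members of each ensemble coincide, so decoding
outside the class of `G` means decoding a graph other than `G`. The law `data₀` of the data with all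
edges deleted is the same for every `G`. The log-likelihood ratio of `data n θ G` against it is a
sum over observations and nodes. Nodes without parents contribute nothing and every other node has
mean at most `Δmax`, so the mean is at most `n * |T| * Δmax`, where `T` contains all nodes that can
have parents. Fano's inequality (`sum_measureReal_mul_log_le`) bounds the average probability of
success by `(n * |T| * Δmax + log 2) / log N`, with `N` the size of the ensemble. This is at most
1/2 under the hypothesis of `KLBounded.half_le_err`.

It remains to bound `log N` from below. Call an edge `u → v` covered if the parents of `v` are `u`
and the parents of `u`. A DAG without covered edges is alone in its Markov class
(`MarkovEquiv.eq_of_forall_not_covered`), so essential DAGs arise by choosing parent sets node by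
node, where each earlier node forbids only one set. In a layered DAG the skeleton fixes all
directions, and the parent sets are chosen independently inside the next layer.

The exponential family condition bounds the symmetrized divergence, hence the divergence itself
(`klDiv_expFamily_le`). -/

section Marginal

/-! ### Integration of product densities over some of the coordinates -/

variable {ι : Type*} [DecidableEq ι] {X : ι → Type*} [∀ i, MeasurableSpace (X i)]
  {μ : ∀ i, Measure (X i)}

theorem lmarginal_mul_left {s : Finset ι} {f g : (∀ i, X i) → ℝ≥0∞} (hf : Measurable f)
    (hg : ∀ x y, (∀ i ∉ s, x i = y i) → g x = g y) :
    lmarginal μ s (fun x => g x * f x) = fun x => g x * lmarginal μ s f x := by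
  ext x
  have h : ∀ y, g (Function.updateFinset x s y) = g x := fun y =>
    hg _ _ fun i hi => by simp [Function.updateFinset, hi]
  simp only [lmarginal, h]
  exact lintegral_const_mul _ (hf.comp measurable_updateFinset)

variable [∀ i, SigmaFinite (μ i)]

theorem lmarginal_prod_eval {f : ∀ i, X i → ℝ≥0∞} (hf : ∀ i, Measurable (f i)) (s : Finset ι) :
    lmarginal μ s (fun x => ∏ i ∈ s, f i (x i)) = fun _ => ∏ i ∈ s, ∫⁻ y, f i y ∂μ i := by
  have hm : ∀ s : Finset ι, Measurable fun x : ∀ i, X i => ∏ i ∈ s, f i (x i) := fun s =>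
    Finset.measurable_prod _ fun i _ => (hf i).comp (measurable_pi_apply i)
  induction s using Finset.induction_on with
  | empty => simp
  | insert a s ha ih =>
    have h1 : (fun x : ∀ i, X i => ∏ i ∈ insert a s, f i (x i)) =
        fun x => f a (x a) * ∏ i ∈ s, f i (x i) := by
      ext x; rw [Finset.prod_insert ha]
    ext x
    rw [lmarginal_insert _ (hm _) ha, h1, lmarginal_mul_left (hm s)
      (fun x y h => by rw [h a ha]), ih]
    simp only [Function.update_self]
    rw [lintegral_mul_const _ (hf a), Finset.prod_insert ha]

theorem lintegral_prod_eval [Fintype ι] {f : ∀ i, X i → ℝ≥0∞} (hf : ∀ i, Measurable (f i)) :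
    ∫⁻ x, ∏ i, f i (x i) ∂Measure.pi μ = ∏ i, ∫⁻ y, f i y ∂μ i := by
  by_cases h : Nonempty (∀ i, X i)
  · obtain ⟨x⟩ := h
    rw [lintegral_eq_lmarginal_univ x, lmarginal_prod_eval hf]
  · have h' := not_nonempty_iff.mp h
    rw [lintegral_of_isEmpty]
    obtain ⟨i, hi⟩ := isEmpty_pi.mp h'
    exact (Finset.prod_eq_zero (Finset.mem_univ i) (lintegral_of_isEmpty _ _)).symm

theorem pi_withDensity [Fintype ι] {f : ∀ i, X i → ℝ≥0∞} (hf : ∀ i, Measurable (f i))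
    (hσ : ∀ i, SigmaFinite ((μ i).withDensity (f i))) :
    Measure.pi (fun i => (μ i).withDensity (f i)) =
      (Measure.pi μ).withDensity fun x => ∏ i, f i (x i) := by
  refine Measure.pi_eq fun s hs => ?_
  rw [withDensity_apply _ (MeasurableSet.univ_pi hs), ← lintegral_indicator
    (MeasurableSet.univ_pi hs)]
  have : ∀ x, (Set.univ.pi s).indicator (fun x => ∏ i, f i (x i)) x =
      ∏ i, (s i).indicator (f i) (x i) := by
    intro x
    by_cases hx : x ∈ Set.univ.pi s
    · rw [Set.indicator_of_mem hx]
      exact Finset.prod_congr rfl fun i _ => (Set.indicator_of_mem (hx i trivial) _).symm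
    · rw [Set.indicator_of_notMem hx]
      simp only [Set.mem_pi, Set.mem_univ, true_implies, not_forall] at hx
      obtain ⟨i, hi⟩ := hx
      exact (Finset.prod_eq_zero (Finset.mem_univ i) (Set.indicator_of_notMem hi _)).symm
  simp only [this]
  rw [lintegral_prod_eval fun i => (hf i).indicator (hs i)]
  exact Finset.prod_congr rfl fun i _ => by
    rw [lintegral_indicator (hs i), withDensity_apply _ (hs i)]

/-! ### Densities that factorize along an acyclic relation -/

variable [Fintype ι] {R : ι → ι → Prop} {p : ι → (∀ i, X i) → ℝ≥0∞}

/-- Integrate out a set closed under children. A source `v` of `s` has a density that involves no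
other coordinate of `s`, so it leaves the inner integral, which is 1 by induction, and then
integrates to 1 itself. -/
theorem lmarginal_prod_of_acyclic (hR : ∀ v, ¬ Relation.TransGen R v v)
    (hp : ∀ j, Measurable (p j))
    (hdep : ∀ j x y, x j = y j → (∀ i, R i j → x i = y i) → p j x = p j y)
    (hint : ∀ j x, ∫⁻ y, p j (Function.update x j y) ∂μ j = 1) (s : Finset ι)
    (hs : ∀ i ∈ s, ∀ j, R i j → j ∈ s) :
    lmarginal μ s (fun x => ∏ j ∈ s, p j x) = fun _ => 1 := by
  have hm : ∀ s : Finset ι, Measurable fun x : ∀ i, X i => ∏ i ∈ s, p i x := fun s =>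
    Finset.measurable_prod _ fun i _ => hp i
  induction s using Finset.strongInduction with
  | H s ih =>
    rcases s.eq_empty_or_nonempty with rfl | hne
    · simp
    · have : IsTrans ι (Relation.TransGen R) := ⟨fun _ _ _ => Relation.TransGen.trans⟩
      have : Std.Irrefl (Relation.TransGen R) := ⟨hR⟩
      have hwf : WellFounded (Relation.TransGen R) := Finite.wellFounded_of_trans_of_irrefl _
      obtain ⟨v, hv, hmin⟩ := hwf.has_min (s : Set ι) hne
      -- Minimality makes `v` a source of `s`, so `s.erase v` is again closed under children.
      rw [Finset.mem_coe] at hv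
      have hpar : ∀ i ∈ s, ¬ R i v := fun i hi h => hmin i hi (.single h)
      have hsplit : (fun x : ∀ i, X i => ∏ j ∈ s, p j x) =
          fun x => p v x * ∏ j ∈ s.erase v, p j x := by
        ext x; exact (Finset.mul_prod_erase s (fun j => p j x) hv).symm
      ext x
      rw [lmarginal_erase _ (hm s) hv, hsplit, lmarginal_mul_left (hm _), ih _
        (Finset.erase_ssubset hv)]
      · simp [hint]
      · intro i hi j hij
        rw [Finset.mem_erase] at hi ⊢
        exact ⟨fun h => hpar i hi.2 (h ▸ hij), hs i hi.2 j hij⟩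
      · intro x y h
        exact hdep v x y (h v (Finset.notMem_erase v s)) fun i hi =>
          h i fun h' => hpar i (Finset.mem_of_mem_erase h') hi

theorem lintegral_prod_of_acyclic (hR : ∀ v, ¬ Relation.TransGen R v v)
    (hp : ∀ j, Measurable (p j))
    (hdep : ∀ j x y, x j = y j → (∀ i, R i j → x i = y i) → p j x = p j y)
    (hint : ∀ j x, ∫⁻ y, p j (Function.update x j y) ∂μ j = 1) (x : ∀ i, X i) :
    ∫⁻ x, ∏ j, p j x ∂Measure.pi μ = 1 := by
  rw [lintegral_eq_lmarginal_univ x, lmarginal_prod_of_acyclic hR hp hdep hint]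
  simp

/-- The tower property: the expectation of a function of a node and its parents is that of its
conditional expectation `gbar` given the parents. Both integrands have the same marginal over the
descendants of `i`, since the factors of all other nodes come out and what remains is `gbar` in
either case. -/
theorem lintegral_mul_prod_of_acyclic (hR : ∀ v, ¬ Relation.TransGen R v v)
    (hp : ∀ j, Measurable (p j))
    (hdep : ∀ j x y, x j = y j → (∀ i, R i j → x i = y i) → p j x = p j y)
    (hint : ∀ j x, ∫⁻ y, p j (Function.update x j y) ∂μ j = 1) (i : ι)
    {g : (∀ i, X i) → ℝ≥0∞} (hg : Measurable g)
    (hgdep : ∀ x y, x i = y i → (∀ j, R j i → x j = y j) → g x = g y) :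
    ∫⁻ x, g x * ∏ j, p j x ∂Measure.pi μ =
      ∫⁻ x, (∫⁻ y, g (Function.update x i y) * p i (Function.update x i y) ∂μ i) *
        ∏ j, p j x ∂Measure.pi μ := by
  classical
  have hm : ∀ s : Finset ι, Measurable fun x : ∀ i, X i => ∏ i ∈ s, p i x := fun s =>
    Finset.measurable_prod _ fun i _ => hp i
  set gbar : (∀ i, X i) → ℝ≥0∞ := fun x =>
    ∫⁻ y, g (Function.update x i y) * p i (Function.update x i y) ∂μ i with hgbar
  have hgbar_eq : gbar = lmarginal μ {i} fun x => g x * p i x := by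
    rw [lmarginal_singleton]
  have hgbar_m : Measurable gbar := hgbar_eq ▸ (hg.mul (hp i)).lmarginal μ
  -- The descendants of `i`, with `i` included. No parent of `i` is among them, so `gbar` is
  -- constant in the coordinates of `s`.
  set s : Finset ι := Finset.univ.filter fun j => Relation.ReflTransGen R i j with hs_def
  have his : i ∈ s := by simp [hs_def, Relation.ReflTransGen.refl]
  have hs : ∀ a ∈ s, ∀ b, R a b → b ∈ s := by
    intro a ha b hab
    simp only [hs_def, Finset.mem_filter, Finset.mem_univ, true_and] at ha ⊢
    exact ha.tail hab
  have hpar : ∀ a ∈ s, ¬ R a i := by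
    intro a ha hai
    simp only [hs_def, Finset.mem_filter, Finset.mem_univ, true_and] at ha
    exact hR i (.tail' ha hai)
  have hsplit : ∀ h : (∀ i, X i) → ℝ≥0∞, (fun x => h x * ∏ j, p j x) =
      fun x => (∏ j ∈ sᶜ, p j x) * (h x * ∏ j ∈ s, p j x) := by
    intro h; ext x
    rw [← Finset.prod_mul_prod_compl s]
    ring
  have hcompl : ∀ x y, (∀ i ∉ s, x i = y i) → ∏ j ∈ sᶜ, p j x = ∏ j ∈ sᶜ, p j y := by
    intro x y h
    refine Finset.prod_congr rfl fun j hj => ?_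
    rw [Finset.mem_compl] at hj
    exact hdep j x y (h j hj) fun a ha => h a fun ha' => hj (hs a ha' j ha)
  have hgm : ∀ s : Finset ι, Measurable fun x => g x * ∏ j ∈ s, p j x := fun s => hg.mul (hm s)
  have hgbm : ∀ s : Finset ι, Measurable fun x => gbar x * ∏ j ∈ s, p j x := fun s =>
    hgbar_m.mul (hm s)
  refine lintegral_eq_of_lmarginal_eq s (hgm _) (hgbm _) ?_
  rw [hsplit g, hsplit gbar, lmarginal_mul_left (hgm s) hcompl,
    lmarginal_mul_left (hgbm s) hcompl]
  have h1 : lmarginal μ s (fun x => gbar x * ∏ j ∈ s, p j x) = gbar := by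
    rw [lmarginal_mul_left (hm s), lmarginal_prod_of_acyclic hR hp hdep hint s hs]
    · simp
    · intro x y h
      refine lintegral_congr fun z => ?_
      have e : ∀ a, R a i → Function.update x i z a = Function.update y i z a := by
        intro a ha
        have hne : a ≠ i := by rintro rfl; exact hR a (.single ha)
        simp [hne, h a fun ha' => hpar a ha' ha]
      rw [hgdep _ _ (by simp) e, hdep i _ _ (by simp) e]
  have h2 : lmarginal μ s (fun x => g x * ∏ j ∈ s, p j x) = gbar := by
    have hsp : (fun x : ∀ i, X i => g x * ∏ j ∈ s, p j x) =
        fun x => (g x * p i x) * ∏ j ∈ s.erase i, p j x := by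
      ext x; rw [← Finset.mul_prod_erase s (fun j => p j x) his, mul_assoc]
    ext x
    rw [lmarginal_erase _ (hgm s) his, hsp, lmarginal_mul_left (hm _),
      lmarginal_prod_of_acyclic hR hp hdep hint]
    · simp [hgbar]
    · intro a ha b hab
      rw [Finset.mem_erase] at ha ⊢
      exact ⟨fun h => hpar a ha.2 (h ▸ hab), hs a ha.2 b hab⟩
    · intro x y h
      have hi := h i (Finset.notMem_erase i s)
      have e : ∀ a, R a i → x a = y a := fun a ha =>
        h a fun h' => hpar a (Finset.mem_of_mem_erase h') ha
      rw [hgdep _ _ hi e, hdep i _ _ hi e]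
  rw [h1, h2]

end Marginal

/-! ### Fano's inequality -/

/-- One term of a Fano-type inequality, by a change of measure from `P` to `Q`. -/
theorem measureReal_mul_log_le {Ω : Type*} [MeasurableSpace Ω] {P Q : Measure Ω}
    [IsProbabilityMeasure P] [IsFiniteMeasure Q] (hQ : Q Set.univ ≤ 1)
    {ρ : Ω → ℝ≥0∞} (hρ : Measurable ρ)
    {ℓ : Ω → ℝ} (hℓ : Integrable ℓ P) (hρℓ : ∀ᵐ x ∂P, ρ x = ENNReal.ofReal (Real.exp (-ℓ x)))
    (hPQ : ∀ A, MeasurableSet A → ∫⁻ x in A, ρ x ∂P ≤ Q A) {A : Set Ω} (hA : MeasurableSet A)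
    {N : ℝ} (hN : 1 ≤ N) :
    P.real A * Real.log N ≤
      ∫ x, ℓ x ∂P + Real.log 2 - 1 / 2 + (N - 1) / 2 * Q.real A := by
  have hfin : ∀ A, MeasurableSet A → ∫⁻ x in A, ρ x ∂P ≠ ∞ := fun A hA =>
    ((hPQ A hA).trans_lt (measure_lt_top _ _)).ne
  have hexp : Integrable (fun x => Real.exp (-ℓ x)) P := by
    have h1 : Integrable (fun x => (ρ x).toReal) P := by
      refine integrable_toReal_of_lintegral_ne_top hρ.aemeasurable ?_
      simpa using hfin _ MeasurableSet.univ
    refine h1.congr ?_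
    filter_upwards [hρℓ] with x hx
    rw [hx, ENNReal.toReal_ofReal (Real.exp_pos _).le]
  have hexpA : ∀ A, MeasurableSet A → ∫ x in A, Real.exp (-ℓ x) ∂P ≤ Q.real A := by
    intro A hA
    rw [integral_eq_lintegral_of_nonneg_ae (ae_of_all _ fun x => (Real.exp_pos _).le)
      hexp.restrict.aestronglyMeasurable]
    refine ENNReal.toReal_mono (measure_ne_top _ _) (le_trans (le_of_eq ?_) (hPQ A hA))
    refine lintegral_congr_ae ?_
    filter_upwards [ae_restrict_of_ae hρℓ] with x hx using hx.symm
  -- This is `t + 1 ≤ exp t` at `t = log (N/2) - ℓ` on `A` and at `t = -log 2 - ℓ` off `A`. The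
  -- weights `N/2` and `1/2` have mean about 1 when `A` has `Q`-mass `1/N`.
  have hpt : ∀ x, A.indicator (fun _ => Real.log N) x + (1 - Real.log 2) - ℓ x ≤
      (1 / 2) * Real.exp (-ℓ x) +
        ((N - 1) / 2) * A.indicator (fun x => Real.exp (-ℓ x)) x := by
    intro x
    by_cases hx : x ∈ A
    · simp only [Set.indicator_of_mem hx]
      have h1 := Real.add_one_le_exp (Real.log N - Real.log 2 - ℓ x)
      have h2 : Real.exp (Real.log N - Real.log 2 - ℓ x) = N / 2 * Real.exp (-ℓ x) := by
        rw [sub_eq_add_neg, Real.exp_add, Real.exp_sub, Real.exp_log (by linarith),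
          Real.exp_log two_pos]
      linarith
    · simp only [Set.indicator_of_notMem hx]
      have h1 := Real.add_one_le_exp (- Real.log 2 - ℓ x)
      have h2 : Real.exp (- Real.log 2 - ℓ x) = 1 / 2 * Real.exp (-ℓ x) := by
        rw [sub_eq_add_neg, Real.exp_add, Real.exp_neg, Real.exp_log two_pos, one_div]
      linarith
  have hi1 : Integrable (A.indicator fun _ => Real.log N) P :=
    (integrable_const _).indicator hA
  have hi2 : Integrable (fun x => A.indicator (fun _ => Real.log N) x + (1 - Real.log 2)) P :=
    hi1.add (integrable_const _)
  have hi3 : Integrable (fun x => (1 / 2) * Real.exp (-ℓ x)) P := hexp.const_mul _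
  have hi4 : Integrable
      (fun x => ((N - 1) / 2) * A.indicator (fun x => Real.exp (-ℓ x)) x) P :=
    (hexp.indicator hA).const_mul _
  have h := integral_mono (hi2.sub hℓ) (hi3.add hi4) hpt
  simp only [Pi.sub_apply, Pi.add_apply] at h
  rw [integral_sub hi2 hℓ, integral_add hi1 (integrable_const _), integral_indicator hA,
    integral_add hi3 hi4, integral_const_mul, integral_const_mul, integral_indicator hA] at h
  simp only [integral_const, MeasurableSet.univ, measureReal_restrict_apply, Set.univ_inter,
    smul_eq_mul, probReal_univ, one_mul] at h
  have h3 := hexpA A hA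
  have h4 := hexpA _ MeasurableSet.univ
  have h5 : Q.real Set.univ ≤ 1 := ENNReal.toReal_mono ENNReal.one_ne_top hQ
  rw [setIntegral_univ] at h4
  have h6 := mul_le_mul_of_nonneg_left h3 (show 0 ≤ (N - 1) / 2 by linarith)
  linarith

/-- Disjointness gives the sets `A g` total `Q`-mass at most 1, so the last terms of
`measureReal_mul_log_le` add up to at most `(N - 1) / 2`, less than the `N / 2` subtracted. -/
theorem sum_measureReal_mul_log_le {Ω ι : Type*} [MeasurableSpace Ω] [Fintype ι] [Nonempty ι]
    {P : ι → Measure Ω} [∀ g, IsProbabilityMeasure (P g)] {Q : Measure Ω}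
    (hQ : Q Set.univ ≤ 1) {ρ : ι → Ω → ℝ≥0∞} (hρ : ∀ g, Measurable (ρ g))
    {ℓ : ι → Ω → ℝ} (hℓ : ∀ g, Integrable (ℓ g) (P g))
    (hρℓ : ∀ g, ∀ᵐ x ∂P g, ρ g x = ENNReal.ofReal (Real.exp (-ℓ g x)))
    (hPQ : ∀ g A, MeasurableSet A → ∫⁻ x in A, ρ g x ∂P g ≤ Q A) {K : ℝ}
    (hK : ∀ g, ∫ x, ℓ g x ∂P g ≤ K) {A : ι → Set Ω} (hA : ∀ g, MeasurableSet (A g))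
    (hd : Pairwise fun g h => Disjoint (A g) (A h)) :
    (∑ g, (P g).real (A g)) * Real.log (Fintype.card ι) ≤
      Fintype.card ι * (K + Real.log 2) := by
  have : IsFiniteMeasure Q := ⟨hQ.trans_lt ENNReal.one_lt_top⟩
  have hN : (1 : ℝ) ≤ Fintype.card ι := by exact_mod_cast Fintype.card_pos
  set N : ℝ := (Fintype.card ι : ℝ)
  have hsum : ∑ g, Q.real (A g) ≤ 1 := by
    have h1 := measureReal_biUnion_finset (μ := Q) (s := Finset.univ) (f := A)
      (fun g _ h _ hgh => hd hgh) (fun g _ => hA g)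
    rw [← h1]
    exact (measureReal_mono (Set.subset_univ _)).trans
      (ENNReal.toReal_mono ENNReal.one_ne_top hQ)
  rw [Finset.sum_mul]
  calc ∑ g, (P g).real (A g) * Real.log N
      ≤ ∑ g, (K + Real.log 2 - 1 / 2 + (N - 1) / 2 * Q.real (A g)) :=
        Finset.sum_le_sum fun g _ => by
          have := measureReal_mul_log_le hQ (hρ g) (hℓ g) (hρℓ g) (hPQ g) (hA g) hN
          linarith [hK g]
    _ = N * (K + Real.log 2 - 1 / 2) + (N - 1) / 2 * ∑ g, Q.real (A g) := by
        rw [Finset.sum_add_distrib, ← Finset.mul_sum, Finset.sum_const,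
          Finset.card_univ, nsmul_eq_mul]
    _ ≤ N * (K + Real.log 2) := by
        have := mul_le_mul_of_nonneg_left hsum (show 0 ≤ (N - 1) / 2 by linarith)
        linarith

/-! ### Markov equivalence: skeletons, colliders and covered edges -/

namespace BN.DAG

variable {m : ℕ} {G H : DAG m}

theorem skeleton_adj {u v : Fin m} : G.skeleton.Adj u v ↔ G.Adj u v ∨ G.Adj v u := by
  rw [skeleton, SimpleGraph.fromRel_adj]
  refine ⟨fun h => h.2, fun h => ⟨?_, h⟩⟩
  rintro rfl
  exact G.acyclic u (.single (h.elim id id))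

theorem not_adj_of_adj {u v : Fin m} (h : G.Adj u v) : ¬ G.Adj v u := fun h' =>
  G.acyclic u (.tail (.single h) h')

theorem not_adj_of_isDescendant {u v : Fin m} (h : G.IsDescendant u v) : ¬ G.Adj v u := fun h' =>
  G.acyclic v (.head' h' h)

theorem not_isDescendant_of_isDescendant {u v : Fin m} (huv : u ≠ v) (h : G.IsDescendant u v) :
    ¬ G.IsDescendant v u := by
  intro h'
  rcases Relation.reflTransGen_iff_eq_or_transGen.mp h with rfl | h
  · exact huv rfl
  · exact G.acyclic u (h.trans_left h')

theorem MarkovEquiv.refl (G : DAG m) : G.MarkovEquiv G := fun _ _ _ _ _ _ => Iff.rfl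

theorem MarkovEquiv.symm (h : G.MarkovEquiv H) : H.MarkovEquiv G := fun A B C hAB hAC hBC =>
  (h A B C hAB hAC hBC).symm

/-- Nonadjacent nodes are d-separated by the parents of the later one. -/
theorem indep_parents {a b : Fin m} (hab : ¬ G.skeleton.Adj a b) (hba : ¬ G.IsDescendant b a) :
    G.Indep {a} {b} (G.parents b) := by
  rintro _ rfl _ rfl p ⟨-, hp⟩
  rename_i a b
  have hne : p.length ≠ 0 := by
    intro h
    have := SimpleGraph.Walk.eq_of_length_eq_zero h
    subst this
    exact hba .refl
  -- Walk back from `b`. The last edge cannot enter `b`, as its tail would be `a` or a noncollider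
  -- among the parents of `b`. If a later edge turned around, its collider would descend from `b`
  -- and have a parent of `b` as descendant, a cycle. So every edge points towards `a`, which
  -- becomes a descendant of `b`.
  have key : ∀ t, 1 ≤ t → t ≤ p.length → G.IsDescendant b (p.getVert (p.length - t)) ∧
      G.Adj (p.getVert (p.length - t + 1)) (p.getVert (p.length - t)) := by
    intro t ht
    induction t, ht using Nat.le_induction with
    | base =>
      intro h1
      have hadj := p.adj_getVert_succ (i := p.length - 1) (by omega)
      have e : p.length - 1 + 1 = p.length := by omega
      rw [e, p.getVert_length, skeleton_adj] at hadj
      rw [e, p.getVert_length]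
      have : G.Adj b (p.getVert (p.length - 1)) := by
        refine hadj.resolve_left fun h => ?_
        rcases Nat.eq_zero_or_pos (p.length - 1) with h0 | h0
        · rw [h0, p.getVert_zero] at h
          exact hab (skeleton_adj.2 (.inl h))
        · refine (hp _ h0 (by omega)).2 (fun hc => ?_) h
          have h2 := hc.2
          rw [e, p.getVert_length] at h2
          exact not_adj_of_adj h h2
      exact ⟨.single this, this⟩
    | succ t ht ih =>
      intro h1
      obtain ⟨hd, hadj⟩ := ih (by omega)
      have e : p.length - (t + 1) + 1 = p.length - t := by omega
      have e' : p.length - t - 1 = p.length - (t + 1) := by omega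
      have h2 := p.adj_getVert_succ (i := p.length - (t + 1)) (by omega)
      rw [e, skeleton_adj] at h2
      rw [e]
      have : G.Adj (p.getVert (p.length - t)) (p.getVert (p.length - (t + 1))) := by
        refine h2.resolve_left fun h => ?_
        obtain ⟨c, hc, hcd⟩ := (hp (p.length - t) (by omega) (by omega)).1
          ⟨by rw [e']; exact h, hadj⟩
        exact not_adj_of_isDescendant (Relation.ReflTransGen.trans hd hcd) hc
      exact ⟨hd.tail this, this⟩
  have h := (key p.length (by omega) le_rfl).1
  rw [Nat.sub_self, p.getVert_zero] at h
  exact hba h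

theorem not_indep_of_adj {a b : Fin m} (hab : G.skeleton.Adj a b) (C : Set (Fin m)) :
    ¬ G.Indep {a} {b} C := by
  intro h
  refine h a rfl b rfl hab.toWalk ⟨by simp [hab.ne], ?_⟩
  intro i h0 h1
  simp at h1
  omega

theorem not_indep_of_not_collider {a b c : Fin m} {C : Set (Fin m)} (hac : G.skeleton.Adj a c)
    (hcb : G.skeleton.Adj c b) (hab : a ≠ b) (hcol : ¬ (G.Adj a c ∧ G.Adj b c)) (hc : c ∉ C) :
    ¬ G.Indep {a} {b} C := by
  intro h
  refine h a rfl b rfl (.cons hac hcb.toWalk) ⟨?_, ?_⟩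
  · simp [hcb.ne, hac.ne, hab]
  · intro i h0 h1
    simp at h1
    obtain rfl : i = 1 := by omega
    exact ⟨fun h' => (hcol (by simpa using h')).elim, fun _ => by simpa using hc⟩

/-- Of two distinct nodes, one is no descendant of the other. -/
theorem not_isDescendant_or {a b : Fin m} (hab : a ≠ b) :
    ¬ G.IsDescendant b a ∨ ¬ G.IsDescendant a b := by
  by_contra! h
  exact not_isDescendant_of_isDescendant hab h.2 h.1

theorem MarkovEquiv.indep_iff (h : G.MarkovEquiv H) {a b : Fin m} (hab : a ≠ b)
    {C : Set (Fin m)} (ha : a ∉ C) (hb : b ∉ C) : G.Indep {a} {b} C ↔ H.Indep {a} {b} C :=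
  h _ _ _ (by simpa using hab) (by simpa using ha) (by simpa using hb)

theorem notMem_parents_self (b : Fin m) : b ∉ G.parents b := fun h => not_adj_of_adj h h

/-- Adjacent nodes are never d-separated, whereas nonadjacent ones are separated by the parents of
one of them. -/
theorem MarkovEquiv.skeleton_adj_of_adj (h : G.MarkovEquiv H) {a b : Fin m}
    (hab : G.skeleton.Adj a b) : H.skeleton.Adj a b := by
  have key : ∀ {a b : Fin m}, G.skeleton.Adj a b → ¬ H.IsDescendant b a →
      H.skeleton.Adj a b := by
    intro a b hab hd
    by_contra hn
    refine not_indep_of_adj hab (H.parents b) ((h.indep_iff hab.ne ?_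
      (notMem_parents_self b)).2 (indep_parents hn hd))
    exact fun h' => hn (skeleton_adj.2 (.inl h'))
  rcases not_isDescendant_or (G := H) hab.ne with hd | hd
  · exact key hab hd
  · exact (key hab.symm hd).symm

/-- The parents of `b` separate `a` from `b` in `G` and do not contain `c`. If `c` were not a
collider in `H`, the path through `c` would be active there given this set. -/
theorem MarkovEquiv.adj_of_collider (h : G.MarkovEquiv H) {a b c : Fin m} (hac : G.Adj a c)
    (hbc : G.Adj b c) (hne : a ≠ b) (hab : ¬ G.skeleton.Adj a b) : H.Adj a c ∧ H.Adj b c := by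
  have key : ∀ {a b : Fin m}, G.Adj a c → G.Adj b c → a ≠ b → ¬ G.skeleton.Adj a b →
      ¬ G.IsDescendant b a → H.Adj a c ∧ H.Adj b c := by
    intro a b hac hbc hne hab hd
    by_contra hn
    refine not_indep_of_not_collider (C := G.parents b)
      (h.skeleton_adj_of_adj (skeleton_adj.2 (.inl hac)))
      (h.skeleton_adj_of_adj (skeleton_adj.2 (.inr hbc))) hne hn (not_adj_of_adj hbc) ?_
    exact (h.indep_iff hne (fun h' => hab (skeleton_adj.2 (.inl h')))
      (notMem_parents_self b)).1 (indep_parents hab hd)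
  rcases not_isDescendant_or (G := G) hne with hd | hd
  · exact key hac hbc hne hab hd
  · exact (key hbc hac hne.symm (fun h => hab h.symm) hd).symm

theorem ext_adj (h : ∀ u v, G.Adj u v ↔ H.Adj u v) : G = H :=
  toDigraph_injective m (Digraph.ext (by ext u v; exact h u v))

/-- A DAG without covered edges is the only one in its Markov equivalence class. -/
theorem MarkovEquiv.eq_of_forall_not_covered (hlt : ∀ u v, G.Adj u v → u < v)
    (hcov : ∀ u v, G.Adj u v → G.parents v ≠ insert u (G.parents u)) (h : G.MarkovEquiv H) :
    G = H := by
  by_contra hGH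
  have hor : ∀ {u v}, G.Adj u v → H.Adj u v ∨ H.Adj v u := fun huv =>
    skeleton_adj.1 (h.skeleton_adj_of_adj (skeleton_adj.2 (.inl huv)))
  have hex : ∃ y x, G.Adj x y ∧ H.Adj y x := by
    by_contra! hn
    refine hGH (ext_adj fun u v => ⟨fun huv => (hor huv).resolve_right (hn _ _ huv),
      fun huv => ?_⟩)
    rcases skeleton_adj.1 (h.symm.skeleton_adj_of_adj (skeleton_adj.2 (.inl huv))) with h1 | h1
    · exact h1
    · exact (hn _ _ h1 huv).elim
  -- Among the edges reversed in `H`, take one with the least head `y` and then the greatest tail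
  -- `x`. This edge turns out to be covered: a missing adjacency would create an unshielded collider
  -- in one graph but not in the other, and a wrong direction would give a cycle or contradict the
  -- extremal choice.
  obtain ⟨y, hy, hymin⟩ := wellFounded_lt.has_min {y | ∃ x, G.Adj x y ∧ H.Adj y x} hex
  obtain ⟨x, ⟨hxy, hyx⟩, hxmax⟩ := wellFounded_gt.has_min {x | G.Adj x y ∧ H.Adj y x} hy
  have hmin : ∀ {u v}, G.Adj u v → v < y → H.Adj u v := fun huv hv =>
    (hor huv).resolve_right fun hvu => hymin _ ⟨_, huv, hvu⟩ hv
  refine hcov x y hxy (Set.Subset.antisymm (fun z hz => ?_) (Set.insert_subset hxy fun z hz => ?_))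
  · by_cases hzx : z = x
    · exact .inl hzx
    refine .inr ?_
    by_cases hadj : G.skeleton.Adj z x
    · rcases skeleton_adj.1 hadj with h1 | h1
      · exact h1
      · exfalso
        rcases hor hz with h2 | h2
        · have h3 := hmin h1 (hlt _ _ hz)
          exact H.acyclic x (.tail (.tail (.single h3) h2) hyx)
        · exact hxmax z ⟨hz, h2⟩ (hlt _ _ h1)
    · exact (not_adj_of_adj hyx (h.adj_of_collider hz hxy hzx hadj).2).elim
  · have hz' : H.Adj z x := hmin hz (hlt _ _ hxy)
    by_cases hadj : G.skeleton.Adj z y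
    · refine (skeleton_adj.1 hadj).resolve_right fun h1 => ?_
      exact G.acyclic z (.tail (.tail (.single hz) hxy) h1)
    · have hzy : z ≠ y := by rintro rfl; exact not_adj_of_adj hz hxy
      exact (not_adj_of_adj hxy (h.symm.adj_of_collider hz' hyx hzy
        fun h' => hadj (h.symm.skeleton_adj_of_adj h')).2).elim

theorem mem_essentialDAGs_of_forall_not_covered (hlt : ∀ u v, G.Adj u v → u < v)
    (hcov : ∀ u v, G.Adj u v → G.parents v ≠ insert u (G.parents u)) : G ∈ essentialDAGs m := by
  have : G.markovClass = {G} := by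
    ext H
    exact ⟨fun h => (MarkovEquiv.eq_of_forall_not_covered hlt hcov h).symm,
      fun h => h ▸ MarkovEquiv.refl G⟩
  simp [essentialDAGs, this]

theorem MarkovEquiv.eq_of_mem_essentialDAGs (hG : G ∈ essentialDAGs m) (h : G.MarkovEquiv H) :
    G = H := by
  obtain ⟨K, hK⟩ := Set.ncard_eq_one.1 hG
  have h1 : G ∈ G.markovClass := MarkovEquiv.refl G
  have h2 : H ∈ G.markovClass := h
  rw [hK] at h1 h2
  exact h1.trans h2.symm

/-- The skeletons agree, and the layers leave only one direction for each edge. -/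
theorem MarkovEquiv.eq_of_mem_layeredDAGs {l : ℕ} {lay : Fin m → Fin l}
    (hG : G ∈ layeredDAGs lay) (hH : H ∈ layeredDAGs lay) (h : G.MarkovEquiv H) : G = H := by
  have key : ∀ {G H : DAG m}, G ∈ layeredDAGs lay → H ∈ layeredDAGs lay → G.MarkovEquiv H →
      ∀ u v, G.Adj u v → H.Adj u v := by
    intro G H hG hH h u v huv
    refine (skeleton_adj.1 (h.skeleton_adj_of_adj (skeleton_adj.2 (.inl huv)))).resolve_right
      fun hvu => ?_
    have h1 := hG u v huv
    have h2 := hH v u hvu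
    omega
  exact ext_adj fun u v => ⟨key hG hH h u v, key hH hG h.symm u v⟩

end BN.DAG

/-! ### Counting tools -/

/-- Counting sequences whose admissible entries depend on the preceding ones. -/
theorem exists_injective_of_le_card {m : ℕ} {α : Type*} [Inhabited α]
    (C : Fin m → (Fin m → α) → Finset α)
    (hC : ∀ i g g', (∀ j < i, g j = g' j) → C i g = C i g') (b : Fin m → ℕ)
    (hb : ∀ i g, b i ≤ (C i g).card) :
    ∃ F : (∀ i, Fin (b i)) → Fin m → α, Function.Injective F ∧ ∀ c i, F c i ∈ C i (F c) := by
  let e : ∀ i (s : Finset α), b i ≤ s.card → Fin (b i) ↪ s := fun i s h =>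
    (Fin.castLEEmb h).trans s.equivFin.symm.toEmbedding
  -- Entries from `i` on are filled with `default`; by `hC` they do not affect the set of admissible
  -- choices at `i`.
  let ext : ∀ i : Fin m, (∀ j, j < i → α) → Fin m → α := fun i g j =>
    if h : j < i then g j h else default
  let F : (∀ i, Fin (b i)) → Fin m → α := fun c =>
    wellFounded_lt.fix (C := fun _ => α) fun i g => (e i (C i (ext i g)) (hb _ _) (c i) : α)
  have hF : ∀ c i, F c i = (e i (C i (F c)) (hb _ _) (c i) : α) := by
    intro c i
    have h1 : F c i = (e i (C i (ext i fun j _ => F c j)) (hb _ _) (c i) : α) :=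
      WellFounded.fix_eq _ _ _
    have h2 : C i (ext i fun j _ => F c j) = C i (F c) :=
      hC _ _ _ fun j hj => by simp [ext, hj]
    have h3 : ∀ s t (hs : b i ≤ s.card) (ht : b i ≤ t.card) (x : Fin (b i)), s = t →
        (e i s hs x : α) = (e i t ht x : α) := by
      rintro s t hs ht x rfl
      rfl
    rw [h1]
    exact h3 _ _ _ _ _ h2
  refine ⟨F, fun c c' h => ?_, fun c i => ?_⟩
  · funext i
    have h1 := congrFun h i
    rw [hF, hF, h] at h1
    exact (e i _ _).injective (Subtype.ext h1)
  · rw [hF]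
    exact Subtype.property _

theorem choose_le_card_powerset_filter {α : Type*} (A : Finset α) (k : ℕ) :
    A.card.choose k ≤ (A.powerset.filter fun S => S.card ≤ k).card := by
  rw [← Finset.card_powersetCard]
  refine Finset.card_le_card fun S hS => ?_
  rw [Finset.mem_powersetCard] at hS
  simp [hS.1, hS.2]

/-- Count the subsets of size `k` and the singletons. The surplus `A.card` pays for the parent sets
excluded in `prod_le_card_sparseEssentialDAGs`. -/
theorem choose_add_card_le_card_powerset_filter {α : Type*} [DecidableEq α] (A : Finset α)
    {k : ℕ} (hk : 1 < k) :
    A.card.choose k + A.card ≤ (A.powerset.filter fun S => S.card ≤ k).card := by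
  have hd : Disjoint (A.powersetCard k) (A.powersetCard 1) :=
    Finset.pairwise_disjoint_powersetCard A hk.ne'
  have h1 := Finset.card_union_of_disjoint hd
  rw [Finset.card_powersetCard, Finset.card_powersetCard, Nat.choose_one_right] at h1
  rw [← h1]
  refine Finset.card_le_card fun S hS => ?_
  simp only [Finset.mem_union, Finset.mem_powersetCard] at hS
  simp only [Finset.mem_filter, Finset.mem_powerset]
  exact ⟨hS.elim And.left And.left, hS.elim (fun h => h.2.le) fun h => h.2.le.trans hk.le⟩

/-- Induction through `(n+1).choose (k+1) = (n+1)/(k+1) * n.choose k`, as `(n+1)/(k+1) ≤ n/k`. -/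
theorem div_pow_le_choose {n k : ℕ} (hk : k ≤ n) : ((n : ℝ) / k) ^ k ≤ n.choose k := by
  induction k generalizing n with
  | zero => simp
  | succ k ih =>
    obtain ⟨n, rfl⟩ : ∃ n', n = n' + 1 := ⟨n - 1, by omega⟩
    have hkn : k ≤ n := by omega
    have h1 : ((n + 1 : ℕ) : ℝ) * n.choose k = (n + 1).choose (k + 1) * (k + 1 : ℕ) := by
      exact_mod_cast Nat.add_one_mul_choose_eq n k
    have hk0 : (0 : ℝ) < (k + 1 : ℕ) := by positivity
    have h2 : ((n + 1).choose (k + 1) : ℝ) = ((n + 1 : ℕ) : ℝ) / (k + 1 : ℕ) * n.choose k := by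
      field_simp
      linarith
    rw [h2, pow_succ']
    refine mul_le_mul_of_nonneg_left (le_trans ?_ (ih hkn)) (by positivity)
    rcases Nat.eq_zero_or_pos k with rfl | hk
    · simp
    · refine pow_le_pow_left₀ (by positivity) ?_ _
      rw [div_le_div_iff₀ hk0 (by positivity)]
      push_cast
      have : (k : ℝ) ≤ n := by exact_mod_cast hkn
      nlinarith

theorem mul_log_div_le_log_choose {n k : ℕ} (hk : k ≤ n) :
    k * Real.log ((n : ℝ) / k) ≤ Real.log (n.choose k) := by
  rcases Nat.eq_zero_or_pos k with rfl | hk0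
  · simp
  rw [← Real.log_pow]
  have : (0 : ℝ) < n := by exact_mod_cast hk0.trans_le hk
  exact Real.log_le_log (by positivity) (div_pow_le_choose hk)

/-! ### Sizes of the ensembles -/

namespace BN.DAG

variable {m : ℕ}

/-- The DAG with given parent sets, all edges of which go down in rank. -/
def ofParents (f : Fin m → Finset (Fin m)) (r : Fin m → ℕ) (h : ∀ v, ∀ u ∈ f v, r v < r u) :
    DAG m where
  Adj u v := u ∈ f v
  acyclic v hv := by
    have key : ∀ u w, Relation.TransGen (fun u v => u ∈ f v) u w → r w < r u := by
      intro u w huw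
      induction huw with
      | single h' => exact h _ _ h'
      | tail _ h' ih => exact (h _ _ h').trans ih
    exact lt_irrefl _ (key v v hv)

theorem parents_ofParents {f : Fin m → Finset (Fin m)} {r : Fin m → ℕ}
    {h : ∀ v, ∀ u ∈ f v, r v < r u} (v : Fin m) : (ofParents f r h).parents v = ↑(f v) := rfl

theorem isSparse_ofParents {f : Fin m → Finset (Fin m)} {r : Fin m → ℕ}
    {h : ∀ v, ∀ u ∈ f v, r v < r u} {k : ℕ} (hk : ∀ v, (f v).card ≤ k) :
    (ofParents f r h).IsSparse k := fun v => by
  rw [parents_ofParents, Set.ncard_coe_finset]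
  exact hk v

end BN.DAG

namespace BN

variable {m : ℕ}

/-- Node `i` takes its parents among the earlier nodes `j` and avoids the sets that would make some
`j → i` covered. At most `i` sets are lost, which leaves at least `2 ^ i - i ≥ 2 ^ (i - 1)` choices
when `0 < i < k` and at least `i.choose k` when `k ≤ i`. Assuming `1 < k` only for `k < m` admits `k
= m`, the case without sparsity. -/
theorem prod_le_card_sparseEssentialDAGs {k : ℕ} (hk : k < m → 1 < k) :
    ∏ i ∈ Finset.range m, (if i < k then 2 ^ (i - 1) else i.choose k) ≤
      Fintype.card (sparseEssentialDAGs m k) := by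
  let C : Fin m → (Fin m → Finset (Fin m)) → Finset (Finset (Fin m)) := fun i g =>
    ((Finset.Iio i).powerset.filter fun S => S.card ≤ k) \
      (Finset.Iio i).image fun j => insert j (g j)
  let b : Fin m → ℕ := fun i => if (i : ℕ) < k then 2 ^ ((i : ℕ) - 1) else (i : ℕ).choose k
  have hC : ∀ i g g', (∀ j < i, g j = g' j) → C i g = C i g' := by
    intro i g g' h
    simp only [C]
    congr 1
    refine Finset.image_congr fun j hj => ?_
    rw [h j (by simpa using hj)]
  have hb : ∀ i g, b i ≤ (C i g).card := by
    intro i g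
    have h1 : ((Finset.Iio i).image fun j => insert j (g j)).card ≤ i := by
      simpa using Finset.card_image_le (s := Finset.Iio i) (f := fun j => insert j (g j))
    have h2 := Finset.le_card_sdiff ((Finset.Iio i).image fun j => insert j (g j))
      ((Finset.Iio i).powerset.filter fun S => S.card ≤ k)
    refine le_trans ?_ h2
    simp only [b]
    split_ifs with hi
    · have h3 : (Finset.Iio i).powerset.filter (fun S => S.card ≤ k) =
          (Finset.Iio i).powerset := by
        refine Finset.filter_true_of_mem fun S hS => ?_
        have := Finset.card_le_card (Finset.mem_powerset.1 hS)
        rw [Fin.card_Iio] at this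
        omega
      rw [h3, Finset.card_powerset, Fin.card_Iio]
      rcases Nat.eq_zero_or_pos (i : ℕ) with h0 | h0
      · simp [h0] at h1 ⊢
        simp [h1]
      · obtain ⟨j, hj⟩ : ∃ j, (i : ℕ) = j + 1 := ⟨i - 1, by omega⟩
        rw [hj, pow_succ, Nat.add_sub_cancel]
        have := Nat.lt_two_pow_self (n := j)
        omega
    · have h3 := choose_add_card_le_card_powerset_filter (Finset.Iio i)
        (hk ((not_lt.1 hi).trans_lt i.2))
      rw [Fin.card_Iio] at h3
      omega
  obtain ⟨F, hF, hmem⟩ := exists_injective_of_le_card C hC b hb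
  have hmem' : ∀ c i, (∀ u ∈ F c i, u < i) ∧ (F c i).card ≤ k ∧
      ∀ u < i, F c i ≠ insert u (F c u) := by
    intro c i
    have h := hmem c i
    simp only [C, Finset.mem_sdiff, Finset.mem_filter, Finset.mem_powerset, Finset.mem_image,
      Finset.mem_Iio, not_exists, not_and] at h
    exact ⟨fun u hu => Finset.mem_Iio.1 (h.1.1 hu), h.1.2, fun u hu h' => h.2 u hu h'.symm⟩
  let r : Fin m → ℕ := fun v => m - v
  have hr : ∀ c v, ∀ u ∈ F c v, r v < r u := fun c v u hu => by
    have h1 : (u : ℕ) < v := (hmem' c v).1 u hu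
    have h2 := v.2
    simp only [r]
    omega
  let Φ : (∀ i, Fin (b i)) → sparseEssentialDAGs m k := fun c =>
    ⟨DAG.ofParents (F c) r (hr c), DAG.mem_essentialDAGs_of_forall_not_covered
      (fun u v huv => (hmem' c v).1 u huv)
      (fun u v huv h => (hmem' c v).2.2 u ((hmem' c v).1 u huv) (by
        simp only [DAG.parents_ofParents] at h
        exact_mod_cast h)),
      DAG.isSparse_ofParents fun v => (hmem' c v).2.1⟩
  have hΦ : Function.Injective Φ := fun c c' h =>
    hF (funext fun v => Finset.ext fun u =>
      Iff.of_eq (congrArg (fun G : sparseEssentialDAGs m k => G.1.Adj u v) h))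
  have := Fintype.card_le_of_injective Φ hΦ
  rw [Fintype.card_pi] at this
  simp only [Fintype.card_fin] at this
  rwa [Fin.prod_univ_eq_prod_range (fun i => if i < k then 2 ^ (i - 1) else i.choose k) m] at this

theorem sum_range_sub_one (k : ℕ) (hk : 1 ≤ k) :
    ∑ i ∈ Finset.range k, ((i - 1 : ℕ) : ℝ) = (k - 1) * (k - 2) / 2 := by
  induction k, hk using Nat.le_induction with
  | base => simp
  | succ k hk ih =>
    rw [Finset.sum_range_succ, ih, Nat.cast_sub hk]
    push_cast
    ring

theorem log_card_essentialDAGs (hm : 1 ≤ m) :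
    ((m : ℝ) - 1) * (m - 2) / 2 * Real.log 2 ≤ Real.log (Fintype.card (essentialDAGs m)) := by
  have h1 := prod_le_card_sparseEssentialDAGs (m := m) (k := m) (fun h => (lt_irrefl _ h).elim)
  rw [Finset.prod_congr rfl fun i hi => if_pos (Finset.mem_range.1 hi)] at h1
  have h2 : Fintype.card (sparseEssentialDAGs m m) ≤ Fintype.card (essentialDAGs m) :=
    Fintype.card_le_of_injective (fun G => ⟨G.1, G.2.1⟩) fun G H h => by
      simpa [Subtype.ext_iff] using h
  have h3 : ∏ i ∈ Finset.range m, ((2 : ℝ) ^ (i - 1)) ≤ Fintype.card (essentialDAGs m) := by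
    exact_mod_cast h1.trans h2
  refine le_trans (le_of_eq ?_) (Real.log_le_log (by positivity) h3)
  rw [Real.log_prod (fun i _ => by positivity)]
  simp only [Real.log_pow]
  rw [← Finset.sum_mul, sum_range_sub_one m hm]

/-- Induction on `m`. Both sides vanish at `m = k + 1`; afterwards the left gains `k * (log (m - 1)
- log k)`, at most `k * log (m / k)`, and the right gains `log (m.choose k)`. -/
theorem mul_log_factorial_le {k : ℕ} (hk : 1 < k) (hkm : k + 1 ≤ m) :
    k * (Real.log ((m - 2)! : ℕ) - Real.log (k ! : ℕ) - ((m : ℝ) - k - 2) * Real.log k) ≤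
      ∑ i ∈ Finset.Ico k m, Real.log (i.choose k) := by
  have hk0 : (0 : ℝ) < k := by exact_mod_cast hk.le
  induction m, hkm using Nat.le_induction with
  | base =>
    have e : k = (k - 1) + 1 := by omega
    have h1 : Real.log (k ! : ℕ) = Real.log k + Real.log ((k - 1)! : ℕ) := by
      rw [← Real.log_mul (by positivity) (by positivity)]
      congr 1
      exact_mod_cast (Nat.mul_factorial_pred (by omega)).symm
    have e' : k + 1 - 2 = k - 1 := by omega
    rw [h1, e']
    rw [Nat.Ico_succ_singleton, Finset.sum_singleton, Nat.choose_self]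
    push_cast
    rw [Real.log_one]
    apply le_of_eq
    ring
  | succ m hm ih =>
    rw [Finset.sum_Ico_succ_top (by omega)]
    have h1 : Real.log ((m + 1 - 2)! : ℕ) = Real.log ((m - 1 : ℕ) : ℝ) +
        Real.log ((m - 2)! : ℕ) := by
      have : ((m - 1 : ℕ) : ℝ) ≠ 0 := by
        have : m - 1 ≠ 0 := by omega
        exact_mod_cast this
      rw [← Real.log_mul this (by positivity)]
      congr 1
      have := Nat.mul_factorial_pred (n := m - 1) (by omega)
      rw [show m + 1 - 2 = m - 1 by omega]
      exact_mod_cast this.symm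
    have h2 : k * Real.log ((m : ℝ) / k) ≤ Real.log (m.choose k) :=
      mul_log_div_le_log_choose (by omega)
    have hm0 : (0 : ℝ) < m := hk0.trans (by exact_mod_cast hm)
    rw [Real.log_div hm0.ne' hk0.ne'] at h2
    have h3 : Real.log ((m - 1 : ℕ) : ℝ) ≤ Real.log m := by
      refine Real.log_le_log ?_ (by exact_mod_cast Nat.sub_le _ _)
      have : 0 < m - 1 := by omega
      exact_mod_cast this
    have h4 := mul_le_mul_of_nonneg_left h3 hk0.le
    rw [h1]
    push_cast
    nlinarith

theorem log_card_sparseEssentialDAGs {k : ℕ} (hk : 1 < k) (hkm : k < m) :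
    k * (Real.log ((m - 2)! : ℕ) - Real.log (k ! : ℕ) - ((m : ℝ) - k - 2) * Real.log k) +
      ((k : ℝ) - 1) * (k - 2) / 2 * Real.log 2 ≤
      Real.log (Fintype.card (sparseEssentialDAGs m k)) := by
  have h1 := prod_le_card_sparseEssentialDAGs (m := m) (k := k) (fun _ => hk)
  rw [← Finset.prod_range_mul_prod_Ico _ hkm.le,
    Finset.prod_congr rfl fun i hi => if_pos (Finset.mem_range.1 hi),
    Finset.prod_congr (s₁ := Finset.Ico k m) (g := fun i => i.choose k) rfl
      fun i hi => if_neg (not_lt.2 (Finset.mem_Ico.1 hi).1)] at h1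
  have h3 : (∏ i ∈ Finset.range k, ((2 : ℝ) ^ (i - 1))) *
      (∏ i ∈ Finset.Ico k m, (i.choose k : ℝ)) ≤ Fintype.card (sparseEssentialDAGs m k) := by
    exact_mod_cast h1
  have hpos : ∀ i ∈ Finset.Ico k m, (0 : ℝ) < i.choose k := fun i hi => by
    exact_mod_cast Nat.choose_pos (Finset.mem_Ico.1 hi).1
  have hpos' := Finset.prod_pos hpos
  refine le_trans ?_ (Real.log_le_log (by positivity) h3)
  rw [Real.log_mul (by positivity) hpos'.ne', Real.log_prod (fun i _ => by positivity),
    Real.log_prod (fun i hi => (hpos i hi).ne')]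
  simp only [Real.log_pow]
  rw [← Finset.sum_mul, sum_range_sub_one k hk.le]
  linarith [mul_log_factorial_le hk hkm]

theorem prod_le_card_sparseLayeredDAGs {l : ℕ} (lay : Fin m → Fin l) (k : ℕ) :
    ∏ v, ((Finset.univ.filter fun u => (lay u : ℕ) = lay v + 1).powerset.filter
      fun S => S.card ≤ k).card ≤ Fintype.card (sparseLayeredDAGs lay k) := by
  set B : Fin m → Finset (Finset (Fin m)) := fun v =>
    (Finset.univ.filter fun u => (lay u : ℕ) = lay v + 1).powerset.filter fun S => S.card ≤ k
  have hB : ∀ f : ∀ v, B v, ∀ v, (∀ u ∈ (f v).1, (lay u : ℕ) = lay v + 1) ∧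
      (f v).1.card ≤ k := by
    intro f v
    have h := (f v).2
    simp only [B, Finset.mem_filter, Finset.mem_powerset] at h
    exact ⟨fun u hu => by simpa using h.1 hu, h.2⟩
  let Φ : (∀ v, B v) → sparseLayeredDAGs lay k := fun f =>
    ⟨DAG.ofParents (fun v => (f v).1) (fun v => lay v) fun v u hu => by
      have := (hB f v).1 u hu
      omega, fun u v huv => (hB f v).1 u huv, DAG.isSparse_ofParents fun v => (hB f v).2⟩
  have hΦ : Function.Injective Φ := fun f g h =>
    funext fun v => Subtype.ext (Finset.ext fun u =>
      Iff.of_eq (congrArg (fun G : sparseLayeredDAGs lay k => G.1.Adj u v) h))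
  simpa [Fintype.card_pi] using Fintype.card_le_of_injective Φ hΦ

end BN

/-! ### Log-likelihood ratios and divergence -/

section LogRatio

/-- The positive part of `-log t`, infinite where the logarithm degenerates. -/
noncomputable def negLogPos (t : ℝ≥0∞) : ℝ≥0∞ :=
  if t = 0 ∨ t = ∞ then ∞ else ENNReal.ofReal (-Real.log t.toReal)

theorem measurable_negLogPos : Measurable negLogPos := by
  refine Measurable.ite ?_ measurable_const (by fun_prop)
  exact (measurableSet_singleton 0).union (measurableSet_singleton ∞)

theorem ofReal_neg_log_le_negLogPos (t : ℝ≥0∞) :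
    ENNReal.ofReal (-Real.log t.toReal) ≤ negLogPos t := by
  unfold negLogPos
  split_ifs
  · exact le_top
  · exact le_rfl

theorem ofReal_log_toReal_le (t : ℝ≥0∞) : ENNReal.ofReal (Real.log t.toReal) ≤ t :=
  (ENNReal.ofReal_le_ofReal (Real.log_le_self ENNReal.toReal_nonneg)).trans ENNReal.ofReal_toReal_le

variable {X : Type*} [MeasurableSpace X] {ν : Measure X} {p q : X → ℝ≥0∞}

theorem isProbabilityMeasure_withDensity_of_lintegral_eq_one (h : ∫⁻ y, p y ∂ν = 1) :
    IsProbabilityMeasure (ν.withDensity p) :=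
  ⟨by rw [withDensity_apply _ MeasurableSet.univ, Measure.restrict_univ, h]⟩

/-- Since `log t ≤ t`, the integrand times `p` is at most `p * (q / p) ≤ q`. -/
theorem lintegral_ofReal_log_div_le (hp : Measurable p) (hq : Measurable q)
    (hq1 : ∫⁻ y, q y ∂ν = 1) :
    ∫⁻ y, ENNReal.ofReal (Real.log (q y / p y).toReal) ∂ν.withDensity p ≤ 1 := by
  rw [lintegral_withDensity_eq_lintegral_mul _ hp (by fun_prop), ← hq1]
  refine lintegral_mono fun y => ?_
  exact (mul_le_mul_right (ofReal_log_toReal_le _) _).trans ENNReal.mul_div_le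

/-- With `r` the Radon–Nikodym derivative, `p = q * r` holds `ν`-almost everywhere. Where `p` is
finite and nonzero, so are `q` and `r`, and `q / p` is `1 / r`. -/
theorem withDensity_ratio_ae [SigmaFinite ν] (hp : Measurable p) (hq : Measurable q)
    (hp1 : ∫⁻ y, p y ∂ν = 1) (hq1 : ∫⁻ y, q y ∂ν = 1)
    (hac : ν.withDensity p ≪ ν.withDensity q) :
    ∀ᵐ y ∂ν.withDensity p, (q y / p y ≠ 0 ∧ q y / p y ≠ ∞) ∧
      llr (ν.withDensity p) (ν.withDensity q) y = -Real.log (q y / p y).toReal := by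
  have := isProbabilityMeasure_withDensity_of_lintegral_eq_one hp1
  have := isProbabilityMeasure_withDensity_of_lintegral_eq_one hq1
  set r := (ν.withDensity p).rnDeriv (ν.withDensity q)
  have hr : Measurable r := Measure.measurable_rnDeriv _ _
  have h1 : ν.withDensity p = ν.withDensity (q * r) := by
    rw [withDensity_mul _ hq hr, Measure.withDensity_rnDeriv_eq _ _ hac]
  have h2 : p =ᵐ[ν] q * r :=
    (withDensity_eq_iff_of_sigmaFinite hp.aemeasurable (hq.mul hr).aemeasurable).1 h1
  have h3 : ∀ᵐ y ∂ν, p y < ∞ := ae_lt_top hp (by simp [hp1])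
  rw [ae_withDensity_iff hp]
  filter_upwards [h2, h3] with y hy hy' hy0
  rw [Pi.mul_apply] at hy
  have hq0 : q y ≠ 0 := by rintro h; simp [h] at hy; exact hy0 hy
  have hr0 : r y ≠ 0 := by rintro h; simp [h] at hy; exact hy0 hy
  have hqt : q y ≠ ∞ := by rintro h; simp [h, hr0] at hy; exact hy'.ne hy
  have hrt : r y ≠ ∞ := by rintro h; simp [h, hq0] at hy; exact hy'.ne hy
  have h4 : (q y / p y).toReal = ((r y).toReal)⁻¹ := by
    rw [hy, ENNReal.toReal_div, ENNReal.toReal_mul]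
    have := ENNReal.toReal_ne_zero.2 ⟨hq0, hqt⟩
    have := ENNReal.toReal_ne_zero.2 ⟨hr0, hrt⟩
    field_simp
  refine ⟨⟨ENNReal.div_ne_zero.2 ⟨hq0, hy'.ne⟩, ENNReal.div_ne_top hqt hy0⟩, ?_⟩
  rw [h4, Real.log_inv, neg_neg, llr]

/-- The divergence is the positive minus the negative part of the integrated log-likelihood ratio.
Moving the negative part across gives an inequality in `ℝ≥0∞` that survives infinite divergence and
can be averaged over the parents. -/
theorem lintegral_negLogPos_le [SigmaFinite ν] (hp : Measurable p) (hq : Measurable q)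
    (hp1 : ∫⁻ y, p y ∂ν = 1) (hq1 : ∫⁻ y, q y ∂ν = 1) :
    ∫⁻ y, negLogPos (q y / p y) ∂ν.withDensity p ≤
      InformationTheory.klDiv (ν.withDensity p) (ν.withDensity q) +
        ∫⁻ y, ENNReal.ofReal (Real.log (q y / p y).toReal) ∂ν.withDensity p := by
  have := isProbabilityMeasure_withDensity_of_lintegral_eq_one hp1
  have := isProbabilityMeasure_withDensity_of_lintegral_eq_one hq1
  by_cases hkl : InformationTheory.klDiv (ν.withDensity p) (ν.withDensity q) = ∞
  · simp [hkl]
  obtain ⟨hac, hint⟩ := InformationTheory.klDiv_ne_top_iff.1 hkl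
  have hae := withDensity_ratio_ae hp hq hp1 hq1 hac
  have h1 := InformationTheory.toReal_klDiv_of_measure_eq hac (by simp)
  rw [integral_eq_lintegral_pos_part_sub_lintegral_neg_part hint] at h1
  have e1 : ∫⁻ y, ENNReal.ofReal (llr (ν.withDensity p) (ν.withDensity q) y) ∂ν.withDensity p =
      ∫⁻ y, negLogPos (q y / p y) ∂ν.withDensity p := by
    refine lintegral_congr_ae ?_
    filter_upwards [hae] with y hy
    rw [hy.2, negLogPos, if_neg (by tauto)]
  have e2 : ∫⁻ y, ENNReal.ofReal (-llr (ν.withDensity p) (ν.withDensity q) y) ∂ν.withDensity p =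
      ∫⁻ y, ENNReal.ofReal (Real.log (q y / p y).toReal) ∂ν.withDensity p := by
    refine lintegral_congr_ae ?_
    filter_upwards [hae] with y hy
    rw [hy.2, neg_neg]
  rw [e1, e2] at h1
  have f1 : ∫⁻ y, negLogPos (q y / p y) ∂ν.withDensity p ≠ ∞ := e1 ▸ hint.lintegral_lt_top.ne
  have f2 : ∫⁻ y, ENNReal.ofReal (Real.log (q y / p y).toReal) ∂ν.withDensity p ≠ ∞ :=
    ((lintegral_ofReal_log_div_le hp hq hq1).trans_lt ENNReal.one_lt_top).ne
  rw [← ENNReal.toReal_le_toReal f1 (by finiteness), ENNReal.toReal_add hkl f2, h1]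
  linarith

end LogRatio

/-! ### The joint law of a network -/

namespace BN.Family

theorem restrict_parents_update {X : Type*} {m : ℕ} (G : DAG m) (i : Fin m) (x : Fin m → X)
    (y : X) :
    (fun j : G.parents i => Function.update x i y j) = fun j : G.parents i => x j := by
  funext j
  have hne : (j : Fin m) ≠ i := by
    intro h
    have hj := j.2
    rw [h] at hj
    exact DAG.notMem_parents_self i hj
  simp [hne]

variable {X : Type*} [MeasurableSpace X] {Θ : Type*} [MeasurableSpace Θ] {m : ℕ}
  {ν : Measure X} {Gs : Set (DAG m)} (M : Family ν Θ Gs)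

theorem measurable_dens_comp (G : Gs) (i : Fin m) :
    Measurable fun a : Θ × (Fin m → X) => M.dens a.1 G i (fun j => a.2 j) (a.2 i) :=
  (M.measurable_dens G i).comp
    (f := fun a : Θ × (Fin m → X) => (a.1, (fun j : G.1.parents i => a.2 j), a.2 i)) (by fun_prop)

theorem measurable_dens_comp_right (θ : Θ) (G : Gs) (i : Fin m) :
    Measurable fun x : Fin m → X => M.dens θ G i (fun j => x j) (x i) :=
  (M.measurable_dens_comp G i).comp (f := fun x => (θ, x)) (by fun_prop)

theorem measurable_dens_right (θ : Θ) (G : Gs) (i : Fin m) (z : G.1.parents i → X) :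
    Measurable (M.dens θ G i z) :=
  (M.measurable_dens G i).comp (f := fun y => (θ, z, y)) (by fun_prop)

theorem measurable_dens₀_right (θ : Θ) (i : Fin m) : Measurable (M.dens₀ θ i) :=
  (M.measurable_dens₀ i).comp (f := fun y => (θ, y)) (by fun_prop)

theorem dens_congr (θ : Θ) (G : Gs) (i : Fin m) {x y : Fin m → X} (hi : x i = y i)
    (h : ∀ j, G.1.Adj j i → x j = y j) :
    M.dens θ G i (fun j => x j) (x i) = M.dens θ G i (fun j => y j) (y i) := by
  rw [hi, show (fun j : G.1.parents i => x j) = fun j : G.1.parents i => y j from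
    funext fun j => h j j.2]

theorem lintegral_dens_update (θ : Θ) (G : Gs) (i : Fin m) (x : Fin m → X) :
    ∫⁻ y, M.dens θ G i (fun j => Function.update x i y j) (Function.update x i y i) ∂ν = 1 := by
  simp only [restrict_parents_update, Function.update_self]
  exact M.lintegral_dens _ _ _ _

theorem nonempty_assignment (M : Family ν Θ Gs) (θ : Θ) : Nonempty (Fin m → X) := by
  by_contra h
  obtain ⟨i, hi⟩ := isEmpty_pi.1 (not_nonempty_iff.1 h)
  have := M.lintegral_dens₀ θ i
  rw [lintegral_of_isEmpty] at this
  exact zero_ne_one this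

variable [SigmaFinite ν]

instance isProbabilityMeasure_joint (θ : Θ) (G : Gs) : IsProbabilityMeasure (M.joint θ G) := by
  obtain ⟨x⟩ := M.nonempty_assignment θ
  exact isProbabilityMeasure_withDensity_of_lintegral_eq_one
    (lintegral_prod_of_acyclic G.1.acyclic (M.measurable_dens_comp_right θ G)
      (fun j _ _ => M.dens_congr θ G j) (M.lintegral_dens_update θ G) x)

/-- Integrating out a node under its conditional distribution given the parents. -/
theorem lintegral_joint_eq (θ : Θ) (G : Gs) (i : Fin m) {g : (G.1.parents i → X) → X → ℝ≥0∞}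
    (hg : Measurable fun a : (G.1.parents i → X) × X => g a.1 a.2) :
    ∫⁻ x, g (fun j => x j) (x i) ∂M.joint θ G =
      ∫⁻ x, ∫⁻ y, g (fun j => x j) y ∂M.cond θ G i x ∂M.joint θ G := by
  have hm : Measurable fun x : Fin m → X => ∏ i, M.dens θ G i (fun j => x j) (x i) :=
    Finset.measurable_prod _ fun i _ => M.measurable_dens_comp_right θ G i
  have hg' : Measurable fun x : Fin m → X => g (fun j => x j) (x i) :=
    hg.comp (f := fun x : Fin m → X => ((fun j : G.1.parents i => x j), x i)) (by fun_prop)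
  have hcond : ∀ x : Fin m → X, ∫⁻ y, g (fun j => x j) y ∂M.cond θ G i x =
      ∫⁻ y, g (fun j => x j) y * M.dens θ G i (fun j => x j) y ∂ν := by
    intro x
    have hgx : Measurable fun y => g (fun j => x j) y :=
      hg.comp (f := fun y : X => ((fun j : G.1.parents i => x j), y)) (by fun_prop)
    rw [cond, lintegral_withDensity_eq_lintegral_mul _ (M.measurable_dens_right θ G i _) hgx]
    exact lintegral_congr fun y => mul_comm _ _
  have hinner : Measurable fun x : Fin m → X =>
      ∫⁻ y, g (fun j => x j) y * M.dens θ G i (fun j => x j) y ∂ν := by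
    refine Measurable.lintegral_prod_right' (f := fun a : (Fin m → X) × X =>
      g (fun j => a.1 j) a.2 * M.dens θ G i (fun j => a.1 j) a.2) (Measurable.mul ?_ ?_)
    · exact hg.comp (f := fun a : (Fin m → X) × X =>
        ((fun j : G.1.parents i => a.1 j), a.2)) (by fun_prop)
    · exact (M.measurable_dens G i).comp (f := fun a : (Fin m → X) × X =>
        (θ, (fun j : G.1.parents i => a.1 j), a.2)) (by fun_prop)
  simp only [hcond]
  rw [joint, lintegral_withDensity_eq_lintegral_mul _ hm hg',
    lintegral_withDensity_eq_lintegral_mul _ hm hinner]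
  have h := lintegral_mul_prod_of_acyclic (μ := fun _ : Fin m => ν) G.1.acyclic
    (M.measurable_dens_comp_right θ G)
    (fun j _ _ => M.dens_congr θ G j) (M.lintegral_dens_update θ G) i hg' (fun x y hi h => by
      have e : (fun j : G.1.parents i => x j) = fun j : G.1.parents i => y j :=
        funext fun j => h j j.2
      rw [hi, e])
  simp only [restrict_parents_update, Function.update_self] at h
  simp only [Pi.mul_apply, mul_comm (∏ i, _)]
  exact h

end BN.Family

/-! ### Log-likelihood ratios of the nodes against the edgeless network -/

namespace BN.Family

variable {X : Type*} [MeasurableSpace X] {Θ : Type*} [MeasurableSpace Θ] {m : ℕ}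
  {ν : Measure X} {Gs : Set (DAG m)} (M : Family ν Θ Gs)

/-- The likelihood ratio of node `i`: its density without parents over its conditional density. -/
noncomputable def ratio (θ : Θ) (G : Gs) (i : Fin m) (x : Fin m → X) : ℝ≥0∞ :=
  M.dens₀ θ i (x i) / M.dens θ G i (fun j => x j) (x i)

/-- The log-likelihood ratio of node `i`. -/
noncomputable def logRatio (θ : Θ) (G : Gs) (i : Fin m) (x : Fin m → X) : ℝ :=
  -Real.log (M.ratio θ G i x).toReal

theorem measurable_ratio (θ : Θ) (G : Gs) (i : Fin m) : Measurable (M.ratio θ G i) :=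
  ((M.measurable_dens₀_right θ i).comp (measurable_pi_apply i)).div
    (M.measurable_dens_comp_right θ G i)

theorem measurable_logRatio (θ : Θ) (G : Gs) (i : Fin m) : Measurable (M.logRatio θ G i) :=
  (Real.measurable_log.comp (M.measurable_ratio θ G i).ennreal_toReal).neg

theorem measurable_div_dens (θ : Θ) (G : Gs) (i : Fin m) :
    Measurable fun a : (G.1.parents i → X) × X => M.dens₀ θ i a.2 / M.dens θ G i a.1 a.2 :=
  ((M.measurable_dens₀_right θ i).comp measurable_snd).div
    ((M.measurable_dens G i).comp (f := fun a : (G.1.parents i → X) × X => (θ, a.1, a.2))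
      (by fun_prop))

theorem lintegral_ofReal_logRatio_le (θ : Θ) (G : Gs) (i : Fin m) :
    ∫⁻ x, ENNReal.ofReal (M.logRatio θ G i x) ∂M.joint θ G ≤
      ∫⁻ x, negLogPos (M.ratio θ G i x) ∂M.joint θ G :=
  lintegral_mono fun _ => ofReal_neg_log_le_negLogPos _

/-- The two densities agree, so the real ratio is 1, or 0 in the degenerate case, where `Real.log 0
= 0`. -/
theorem logRatio_eq_zero (θ : Θ) (G : Gs) (i : Fin m) (hi : G.1.parents i = ∅) (x : Fin m → X) :
    M.logRatio θ G i x = 0 := by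
  rw [logRatio, ratio, M.dens_of_parents_eq_empty θ G i hi, ENNReal.toReal_div]
  rcases eq_or_ne (M.dens₀ θ i (x i)).toReal 0 with h | h
  · simp [h]
  · simp [div_self h]

theorem measurable_prod_ratio (n : ℕ) (θ : Θ) (G : Gs) :
    Measurable fun S : Fin n → Fin m → X => ∏ o, ∏ i, M.ratio θ G i (S o) :=
  Finset.measurable_prod _ fun o _ => Finset.measurable_prod _ fun i _ =>
    (M.measurable_ratio θ G i).comp (measurable_pi_apply o)

variable [SigmaFinite ν]

theorem lintegral_ofReal_neg_logRatio_le (θ : Θ) (G : Gs) (i : Fin m) :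
    ∫⁻ x, ENNReal.ofReal (-M.logRatio θ G i x) ∂M.joint θ G ≤ 1 := by
  have h := M.lintegral_joint_eq θ G i
    (g := fun z y => ENNReal.ofReal (Real.log (M.dens₀ θ i y / M.dens θ G i z y).toReal))
    (ENNReal.measurable_ofReal.comp
      (Real.measurable_log.comp (M.measurable_div_dens θ G i).ennreal_toReal))
  simp only [logRatio, ratio, neg_neg]
  rw [h]
  refine (lintegral_mono fun x => lintegral_ofReal_log_div_le (M.measurable_dens_right θ G i _)
    (M.measurable_dens₀_right θ i) (M.lintegral_dens₀ θ i)).trans ?_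
  simp

theorem lintegral_negLogPos_ratio_le (θ : Θ) (G : Gs) (i : Fin m) :
    ∫⁻ x, negLogPos (M.ratio θ G i x) ∂M.joint θ G ≤
      ∫⁻ x, InformationTheory.klDiv (M.cond θ G i x) (M.cond₀ θ i) ∂M.joint θ G +
        ∫⁻ x, ENNReal.ofReal (-M.logRatio θ G i x) ∂M.joint θ G := by
  have hlog : Measurable fun a : (G.1.parents i → X) × X =>
      ENNReal.ofReal (Real.log (M.dens₀ θ i a.2 / M.dens θ G i a.1 a.2).toReal) :=
    ENNReal.measurable_ofReal.comp
      (Real.measurable_log.comp (M.measurable_div_dens θ G i).ennreal_toReal)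
  have h1 := M.lintegral_joint_eq θ G i
    (g := fun z y => ENNReal.ofReal (Real.log (M.dens₀ θ i y / M.dens θ G i z y).toReal)) hlog
  have h2 := M.lintegral_joint_eq θ G i
    (g := fun z y => negLogPos (M.dens₀ θ i y / M.dens θ G i z y))
    (measurable_negLogPos.comp (M.measurable_div_dens θ G i))
  simp only [logRatio, ratio, neg_neg]
  rw [h1, h2]
  refine (lintegral_mono fun x => lintegral_negLogPos_le (M.measurable_dens_right θ G i _)
    (M.measurable_dens₀_right θ i) (M.lintegral_dens θ G i _) (M.lintegral_dens₀ θ i)).trans ?_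
  -- Only the second summand has to be measurable, so measurability of the divergence in the parent
  -- values is not needed.
  refine le_of_eq (lintegral_add_right _ ?_)
  have : Measurable fun a : (Fin m → X) × X =>
      ENNReal.ofReal (Real.log (M.dens₀ θ i a.2 / M.dens θ G i (fun j => a.1 j) a.2).toReal) *
        M.dens θ G i (fun j => a.1 j) a.2 := by
    refine Measurable.mul ?_ ?_
    · exact hlog.comp (f := fun a : (Fin m → X) × X =>
        ((fun j : G.1.parents i => a.1 j), a.2)) (by fun_prop)
    · exact (M.measurable_dens G i).comp (f := fun a : (Fin m → X) × X =>
        (θ, (fun j : G.1.parents i => a.1 j), a.2)) (by fun_prop)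
  have h3 := this.lintegral_prod_right' (ν := ν)
  convert h3 using 2 with x
  have hgx : Measurable fun y => ENNReal.ofReal
      (Real.log (M.dens₀ θ i y / M.dens θ G i (fun j => x j) y).toReal) :=
    hlog.comp (f := fun y : X => ((fun j : G.1.parents i => x j), y)) (by fun_prop)
  rw [lintegral_withDensity_eq_lintegral_mul _ (M.measurable_dens_right θ G i _) hgx]
  exact lintegral_congr fun y => mul_comm _ _

theorem KLBounded.lintegral_negLogPos_ratio_le {M : Family ν Θ Gs} {Δmax : ℝ}
    (hM : M.KLBounded Δmax) (θ : Θ) (G : Gs) (i : Fin m) :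
    ∫⁻ x, negLogPos (M.ratio θ G i x) ∂M.joint θ G ≤
      ENNReal.ofReal Δmax + ∫⁻ x, ENNReal.ofReal (-M.logRatio θ G i x) ∂M.joint θ G :=
  (M.lintegral_negLogPos_ratio_le θ G i).trans (add_le_add_left (hM G i θ) _)

theorem KLBounded.lintegral_negLogPos_ratio_lt_top {M : Family ν Θ Gs} {Δmax : ℝ}
    (hM : M.KLBounded Δmax) (θ : Θ) (G : Gs) (i : Fin m) :
    ∫⁻ x, negLogPos (M.ratio θ G i x) ∂M.joint θ G < ∞ :=
  (hM.lintegral_negLogPos_ratio_le θ G i).trans_lt (ENNReal.add_lt_top.2 ⟨ENNReal.ofReal_lt_top,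
    (M.lintegral_ofReal_neg_logRatio_le θ G i).trans_lt ENNReal.one_lt_top⟩)

/-- `negLogPos` is infinite at the degenerate ratios, and its integral is finite. -/
theorem KLBounded.ratio_ae {M : Family ν Θ Gs} {Δmax : ℝ}
    (hM : M.KLBounded Δmax) (θ : Θ) (G : Gs) (i : Fin m) :
    ∀ᵐ x ∂M.joint θ G, M.ratio θ G i x ≠ 0 ∧ M.ratio θ G i x ≠ ∞ := by
  have h := ae_lt_top (measurable_negLogPos.comp (M.measurable_ratio θ G i))
    (hM.lintegral_negLogPos_ratio_lt_top θ G i).ne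
  filter_upwards [h] with x hx
  by_contra hn
  simp only [Function.comp, negLogPos] at hx
  rw [if_pos (by tauto)] at hx
  exact lt_irrefl _ hx

theorem KLBounded.integrable_logRatio {M : Family ν Θ Gs} {Δmax : ℝ}
    (hM : M.KLBounded Δmax) (θ : Θ) (G : Gs) (i : Fin m) :
    Integrable (M.logRatio θ G i) (M.joint θ G) := by
  refine ⟨(M.measurable_logRatio θ G i).aestronglyMeasurable, ?_⟩
  rw [hasFiniteIntegral_iff_enorm]
  have h : ∀ x, ‖M.logRatio θ G i x‖ₑ ≤
      ENNReal.ofReal (M.logRatio θ G i x) + ENNReal.ofReal (-M.logRatio θ G i x) := by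
    intro x
    rw [Real.enorm_eq_ofReal_abs]
    rcases abs_cases (M.logRatio θ G i x) with ⟨h, -⟩ | ⟨h, -⟩ <;> rw [h]
    · exact le_self_add
    · exact le_add_self
  refine (lintegral_mono h).trans_lt ?_
  rw [lintegral_add_left (M.measurable_logRatio θ G i).ennreal_ofReal]
  exact ENNReal.add_lt_top.2 ⟨(M.lintegral_ofReal_logRatio_le θ G i).trans_lt
    (hM.lintegral_negLogPos_ratio_lt_top θ G i),
    (M.lintegral_ofReal_neg_logRatio_le θ G i).trans_lt ENNReal.one_lt_top⟩

theorem KLBounded.integral_logRatio_le {M : Family ν Θ Gs} {Δmax : ℝ}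
    (hM : M.KLBounded Δmax) (θ : Θ) (G : Gs) (i : Fin m) (hΔ : 0 ≤ Δmax) :
    ∫ x, M.logRatio θ G i x ∂M.joint θ G ≤ Δmax := by
  rw [integral_eq_lintegral_pos_part_sub_lintegral_neg_part (hM.integrable_logRatio θ G i)]
  have hneg := ((M.lintegral_ofReal_neg_logRatio_le θ G i).trans_lt ENNReal.one_lt_top).ne
  have h := ENNReal.toReal_mono (by finiteness) ((M.lintegral_ofReal_logRatio_le θ G i).trans
    (hM.lintegral_negLogPos_ratio_le θ G i))
  rw [ENNReal.toReal_add ENNReal.ofReal_ne_top hneg, ENNReal.toReal_ofReal hΔ] at h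
  linarith

theorem KLBounded.sum_integral_logRatio_le {M : Family ν Θ Gs} {Δmax : ℝ}
    (hM : M.KLBounded Δmax) (hΔ : 0 ≤ Δmax) (θ : Θ) (G : Gs) {T : Finset (Fin m)}
    (hT : ∀ i ∉ T, G.1.parents i = ∅) :
    ∫ x, ∑ i, M.logRatio θ G i x ∂M.joint θ G ≤ T.card * Δmax := by
  rw [integral_finsetSum _ fun i _ => hM.integrable_logRatio θ G i,
    ← Finset.sum_subset (Finset.subset_univ T) fun i _ hi => by
      simp [M.logRatio_eq_zero θ G i (hT i hi)], ← nsmul_eq_mul]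
  exact Finset.sum_le_card_nsmul _ _ _ fun i _ => hM.integral_logRatio_le θ G i hΔ

/-! ### Data sets -/

theorem data_eq (n : ℕ) (θ : Θ) (G : Gs) :
    M.data n θ G = (Measure.pi fun _ : Fin n => Measure.pi fun _ : Fin m => ν).withDensity
      fun S => ∏ o, ∏ i, M.dens θ G i (fun j => S o j) (S o i) := by
  have : ∀ _ : Fin n, SigmaFinite ((Measure.pi fun _ : Fin m => ν).withDensity
      fun x => ∏ i, M.dens θ G i (fun j => x j) (x i)) := fun _ =>
    inferInstanceAs (SigmaFinite (M.joint θ G))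
  exact pi_withDensity (μ := fun _ : Fin n => Measure.pi fun _ : Fin m => ν)
    (f := fun _ x => ∏ i, M.dens θ G i (fun j => x j) (x i)) (fun _ =>
      Finset.measurable_prod _ fun i _ =>
      M.measurable_dens_comp_right θ G i) this

instance isProbabilityMeasure_data (n : ℕ) (θ : Θ) (G : Gs) :
    IsProbabilityMeasure (M.data n θ G) := by
  unfold data
  infer_instance

/-- Singletons of `Θ` may fail to be measurable; this is what allows integration against a Dirac
mass on `Θ`. -/
theorem measurable_data_apply (n : ℕ) (G : Gs) {A : Set (Fin n → Fin m → X)}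
    (hA : MeasurableSet A) : Measurable fun θ => M.data n θ G A := by
  simp only [data_eq, withDensity_apply _ hA]
  refine Measurable.lintegral_prod_right' (f := fun a : Θ × (Fin n → Fin m → X) =>
    ∏ o, ∏ i, M.dens a.1 G i (fun j => a.2 o j) (a.2 o i)) ?_
  exact Finset.measurable_prod _ fun o _ => Finset.measurable_prod _ fun i _ =>
    (M.measurable_dens_comp G i).comp
      (f := fun a : Θ × (Fin n → Fin m → X) => (a.1, a.2 o)) (by fun_prop)

/-- The distribution of a data set when no node has parents. -/
noncomputable def data₀ (n : ℕ) (θ : Θ) : Measure (Fin n → Fin m → X) :=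
  (Measure.pi fun _ : Fin n => Measure.pi fun _ : Fin m => ν).withDensity
    fun S => ∏ o, ∏ i, M.dens₀ θ i (S o i)

theorem data₀_univ (n : ℕ) (θ : Θ) : M.data₀ n θ Set.univ = 1 := by
  rw [data₀, withDensity_apply _ MeasurableSet.univ, Measure.restrict_univ,
    lintegral_prod_eval (f := fun (_ : Fin n) (x : Fin m → X) => ∏ i, M.dens₀ θ i (x i))
      fun _ => Finset.measurable_prod _ fun i _ =>
        (M.measurable_dens₀_right θ i).comp (measurable_pi_apply i)]
  refine Finset.prod_eq_one fun _ _ => ?_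
  rw [lintegral_prod_eval fun i => M.measurable_dens₀_right θ i]
  exact Finset.prod_eq_one fun i _ => M.lintegral_dens₀ θ i

/-- Only an inequality, since the edgeless law may charge sets where the density of the network
vanishes. -/
theorem setLIntegral_prod_ratio_le (n : ℕ) (θ : Θ) (G : Gs) {A : Set (Fin n → Fin m → X)}
    (hA : MeasurableSet A) :
    ∫⁻ S in A, ∏ o, ∏ i, M.ratio θ G i (S o) ∂M.data n θ G ≤ M.data₀ n θ A := by
  have hm : Measurable fun S : Fin n → Fin m → X =>
      ∏ o, ∏ i, M.dens θ G i (fun j => S o j) (S o i) :=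
    Finset.measurable_prod _ fun o _ => Finset.measurable_prod _ fun i _ =>
      (M.measurable_dens_comp_right θ G i).comp (measurable_pi_apply o)
  rw [data_eq, data₀, withDensity_apply _ hA, restrict_withDensity hA,
    lintegral_withDensity_eq_lintegral_mul _ hm (M.measurable_prod_ratio n θ G)]
  refine lintegral_mono fun S => ?_
  simp only [Pi.mul_apply, ← Finset.prod_mul_distrib]
  gcongr
  exact ENNReal.mul_div_le

theorem KLBounded.prod_ratio_ae {M : Family ν Θ Gs} {Δmax : ℝ} (hM : M.KLBounded Δmax)
    (n : ℕ) (θ : Θ) (G : Gs) :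
    ∀ᵐ S ∂M.data n θ G, ∏ o, ∏ i, M.ratio θ G i (S o) =
      ENNReal.ofReal (Real.exp (-∑ o, ∑ i, M.logRatio θ G i (S o))) := by
  have h : ∀ o : Fin n, ∀ᵐ S ∂M.data n θ G, ∀ i,
      M.ratio θ G i (S o) ≠ 0 ∧ M.ratio θ G i (S o) ≠ ∞ := fun o =>
    (measurePreserving_eval (fun _ : Fin n => M.joint θ G) o).quasiMeasurePreserving.ae
      (ae_all_iff.2 fun i => hM.ratio_ae θ G i)
  filter_upwards [ae_all_iff.2 h] with S hS
  rw [← Finset.sum_neg_distrib, Real.exp_sum,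
    ENNReal.ofReal_prod_of_nonneg fun o _ => (Real.exp_pos _).le]
  refine Finset.prod_congr rfl fun o _ => ?_
  rw [← Finset.sum_neg_distrib, Real.exp_sum,
    ENNReal.ofReal_prod_of_nonneg fun o _ => (Real.exp_pos _).le]
  refine Finset.prod_congr rfl fun i _ => ?_
  rw [logRatio, neg_neg, Real.exp_log (ENNReal.toReal_pos (hS o i).1 (hS o i).2),
    ENNReal.ofReal_toReal (hS o i).2]

theorem KLBounded.integrable_sum_logRatio {M : Family ν Θ Gs} {Δmax : ℝ}
    (hM : M.KLBounded Δmax) (n : ℕ) (θ : Θ) (G : Gs) (o : Fin n) :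
    Integrable (fun S : Fin n → Fin m → X => ∑ i, M.logRatio θ G i (S o)) (M.data n θ G) :=
  integrable_comp_eval (μ := fun _ : Fin n => M.joint θ G) (i := o)
    (f := fun x => ∑ i, M.logRatio θ G i x)
    (integrable_finsetSum _ fun i _ => hM.integrable_logRatio θ G i)

theorem KLBounded.integral_sum_logRatio_le {M : Family ν Θ Gs} {Δmax : ℝ}
    (hM : M.KLBounded Δmax) (hΔ : 0 ≤ Δmax) (n : ℕ) (θ : Θ) (G : Gs) {T : Finset (Fin m)}
    (hT : ∀ i ∉ T, G.1.parents i = ∅) :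
    ∫ S, ∑ o, ∑ i, M.logRatio θ G i (S o) ∂M.data n θ G ≤ n * (T.card * Δmax) := by
  rw [integral_finsetSum _ fun o _ => hM.integrable_sum_logRatio n θ G o]
  calc ∑ o : Fin n, ∫ S, ∑ i, M.logRatio θ G i (S o) ∂M.data n θ G
      = ∑ _o : Fin n, ∫ x, ∑ i, M.logRatio θ G i x ∂M.joint θ G :=
        Finset.sum_congr rfl fun o _ =>
          integral_comp_eval (μ := fun _ : Fin n => M.joint θ G) (i := o)
            (f := fun x => ∑ i, M.logRatio θ G i x)
            (integrable_finsetSum _ fun i _ =>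
              hM.integrable_logRatio θ G i).aestronglyMeasurable
    _ ≤ n * (T.card * Δmax) := by
        rw [Finset.sum_const, Finset.card_univ, Fintype.card_fin, nsmul_eq_mul]
        exact mul_le_mul_of_nonneg_left (hM.sum_integral_logRatio_le hΔ θ G hT) (by positivity)

/-- Fano's bound for an ensemble whose members are pairwise not Markov equivalent and in which
only the nodes in `T` may have parents. -/
theorem KLBounded.half_le_err [Nonempty Θ] {M : Family ν Θ Gs} {Δmax : ℝ}
    (hM : M.KLBounded Δmax) (hΔ : 0 ≤ Δmax) (hinj : ∀ G ∈ Gs, ∀ H ∈ Gs, G.MarkovEquiv H → G = H)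
    {T : Finset (Fin m)} (hT : ∀ G ∈ Gs, ∀ i ∉ T, G.parents i = ∅) {n : ℕ}
    (hn : 2 * (n * (T.card * Δmax)) + 2 * Real.log 2 ≤ Real.log (Fintype.card Gs)) :
    1 / 2 ≤ M.err n := by
  obtain ⟨θ⟩ := ‹Nonempty Θ›
  have hlog2 := Real.log_pos one_lt_two
  have hlog : 0 < Real.log (Fintype.card Gs) := by
    refine lt_of_lt_of_le ?_ hn
    positivity
  -- An empty ensemble would have `Real.log 0 = 0`, against `hlog`.
  have : Nonempty Gs := by
    by_contra h
    have := Fintype.card_eq_zero_iff.2 (not_nonempty_iff.1 h)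
    simp [this] at hlog
  refine le_iInf₂ fun Dec hDec => ?_
  refine le_trans ?_ (le_iSup₂ (f := fun (P : Measure Θ) (_ : IsProbabilityMeasure P) =>
    ∑ G : Gs, ∫⁻ θ, (Fintype.card Gs : ℝ≥0∞)⁻¹ *
      M.data n θ G {S | (Dec S).1 ∉ G.1.markovClass} ∂P) (Measure.dirac θ) inferInstance)
  have hset : ∀ G : Gs, {S | (Dec S).1 ∉ G.1.markovClass} = (Dec ⁻¹' {G})ᶜ := by
    intro G
    ext S
    simp only [Set.mem_ofPred_eq, Set.mem_compl_iff, Set.mem_preimage, Set.mem_singleton_iff,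
      not_iff_not]
    refine ⟨fun h => Subtype.ext (hinj _ G.2 _ (Dec S).2 h).symm, fun h => ?_⟩
    rw [h]
    exact DAG.MarkovEquiv.refl _
  have hval : ∀ G : Gs, ∫⁻ θ', (Fintype.card Gs : ℝ≥0∞)⁻¹ *
      M.data n θ' G {S | (Dec S).1 ∉ G.1.markovClass} ∂Measure.dirac θ =
      ENNReal.ofReal ((Fintype.card Gs : ℝ)⁻¹ * (1 - (M.data n θ G).real (Dec ⁻¹' {G}))) := by
    intro G
    rw [hset, lintegral_dirac' _ ((M.measurable_data_apply n G (hDec G).compl).const_mul _),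
      ENNReal.ofReal_mul (by positivity), ENNReal.ofReal_inv_of_pos
        (by exact_mod_cast Fintype.card_pos), ENNReal.ofReal_natCast,
      ← probReal_compl_eq_one_sub (hDec G), ofReal_measureReal]
  simp only [hval]
  rw [← ENNReal.ofReal_sum_of_nonneg fun G _ => mul_nonneg (by positivity)
    (sub_nonneg.2 measureReal_le_one)]
  have hF := sum_measureReal_mul_log_le (P := fun G => M.data n θ G) (M.data₀_univ n θ).le
    (fun G => M.measurable_prod_ratio n θ G)
    (fun G => integrable_finsetSum _ fun o _ => hM.integrable_sum_logRatio n θ G o)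
    (fun G => hM.prod_ratio_ae n θ G)
    (fun G A hA => M.setLIntegral_prod_ratio_le n θ G hA)
    (fun G => hM.integral_sum_logRatio_le hΔ n θ G (hT G.1 G.2))
    hDec (fun G H hGH => Set.disjoint_left.2 fun S hS hS' => hGH (hS.symm.trans hS'))
  have hN : (0 : ℝ) < Fintype.card Gs := by exact_mod_cast Fintype.card_pos
  rw [← Finset.mul_sum, Finset.sum_sub_distrib, Finset.sum_const, Finset.card_univ, nsmul_eq_mul,
    mul_one]
  set s := ∑ G, (M.data n θ G).real (Dec ⁻¹' {G})
  set N : ℝ := (Fintype.card Gs : ℝ)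
  have hs : s ≤ N / 2 := by
    refine le_of_mul_le_mul_right (hF.trans ?_) hlog
    have := mul_le_mul_of_nonneg_left hn hN.le
    linarith
  have h12 : (1 / 2 : ℝ≥0∞) = ENNReal.ofReal (1 / 2) := by
    rw [ENNReal.ofReal_div_of_pos two_pos]
    simp
  rw [h12]
  refine ENNReal.ofReal_le_ofReal ?_
  rw [inv_mul_eq_div, le_div_iff₀ hN]
  linarith

end BN.Family

/-! ### Exponential families -/

section ExponentialFamily

variable {X E : Type*} [MeasurableSpace X] [NormedAddCommGroup E] [InnerProductSpace ℝ E]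
  [CompleteSpace E] [MeasurableSpace E] [BorelSpace E] [SecondCountableTopology E]
  {ν : Measure X} {T : X → E} {h : X → ℝ≥0} {p q : X → ℝ≥0∞} {a b : E} {c d : ℝ}

/-- The carrier `h` cancels, so the log-likelihood ratio is the affine function `u` of `T`,
integrable along with `T`. -/
theorem klDiv_expFamily (hT : Measurable T) (hh : Measurable h)
    (hp : ∀ y, p y = ENNReal.ofReal (Real.exp (inner ℝ a (T y) - c) * h y))
    (hq : ∀ y, q y = ENNReal.ofReal (Real.exp (inner ℝ b (T y) - d) * h y))
    (hp1 : ∫⁻ y, p y ∂ν = 1) (hq1 : ∫⁻ y, q y ∂ν = 1) (hTp : Integrable T (ν.withDensity p)) :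
    InformationTheory.klDiv (ν.withDensity p) (ν.withDensity q) ≠ ∞ ∧
      (InformationTheory.klDiv (ν.withDensity p) (ν.withDensity q)).toReal =
        inner ℝ (a - b) (∫ y, T y ∂ν.withDensity p) - (c - d) := by
  have := isProbabilityMeasure_withDensity_of_lintegral_eq_one hp1
  have := isProbabilityMeasure_withDensity_of_lintegral_eq_one hq1
  set u : X → ℝ := fun y => inner ℝ (a - b) (T y) - (c - d) with hu
  have hr : Measurable fun y => ENNReal.ofReal (Real.exp (u y)) := by fun_prop
  have hqm : Measurable q := by
    rw [show q = _ from funext hq]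
    fun_prop
  have hpq : p = q * fun y => ENNReal.ofReal (Real.exp (u y)) := by
    funext y
    rw [Pi.mul_apply, hp, hq, ← ENNReal.ofReal_mul (by positivity)]
    congr 1
    rw [mul_right_comm, ← Real.exp_add, hu]
    simp only [inner_sub_left]
    ring_nf
  have hμ : ν.withDensity p =
      (ν.withDensity q).withDensity fun y => ENNReal.ofReal (Real.exp (u y)) := by
    rw [hpq, withDensity_mul _ hqm hr]
  have hac : ν.withDensity p ≪ ν.withDensity q := by
    rw [hμ]
    exact withDensity_absolutelyContinuous _ _
  have hllr : llr (ν.withDensity p) (ν.withDensity q) =ᵐ[ν.withDensity p] u := by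
    have h1 := hac.ae_eq (Measure.rnDeriv_withDensity (ν.withDensity q) hr)
    rw [← hμ] at h1
    filter_upwards [h1] with y hy
    rw [llr, hy, ENNReal.toReal_ofReal (Real.exp_pos _).le, Real.log_exp]
  have hint : Integrable (fun y => inner ℝ (a - b) (T y)) (ν.withDensity p) :=
    hTp.const_inner _
  have hu_int : Integrable u (ν.withDensity p) := hint.sub (integrable_const _)
  refine ⟨InformationTheory.klDiv_ne_top hac (hu_int.congr hllr.symm), ?_⟩
  rw [InformationTheory.toReal_klDiv_of_measure_eq hac (by simp), integral_congr_ae hllr,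
    integral_sub hint (integrable_const _), integral_inner hTp]
  simp

/-- The right side is the sum of the divergences in both directions, in which the log-partition
terms cancel; the reverse divergence is nonnegative. -/
theorem klDiv_expFamily_le (hT : Measurable T) (hh : Measurable h)
    (hp : ∀ y, p y = ENNReal.ofReal (Real.exp (inner ℝ a (T y) - c) * h y))
    (hq : ∀ y, q y = ENNReal.ofReal (Real.exp (inner ℝ b (T y) - d) * h y))
    (hp1 : ∫⁻ y, p y ∂ν = 1) (hq1 : ∫⁻ y, q y ∂ν = 1) (hTp : Integrable T (ν.withDensity p))
    (hTq : Integrable T (ν.withDensity q)) :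
    InformationTheory.klDiv (ν.withDensity p) (ν.withDensity q) ≤
      ENNReal.ofReal (inner ℝ (a - b)
        ((∫ y, T y ∂ν.withDensity p) - ∫ y, T y ∂ν.withDensity q)) := by
  obtain ⟨h1, h2⟩ := klDiv_expFamily hT hh hp hq hp1 hq1 hTp
  obtain ⟨-, h3⟩ := klDiv_expFamily hT hh hq hp hq1 hp1 hTq
  have h4 : 0 ≤ inner ℝ (b - a) (∫ y, T y ∂ν.withDensity q) - (d - c) :=
    h3 ▸ ENNReal.toReal_nonneg
  rw [← ENNReal.ofReal_toReal h1, h2]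
  refine ENNReal.ofReal_le_ofReal ?_
  simp only [inner_sub_left, inner_sub_right] at h4 ⊢
  linarith

end ExponentialFamily

namespace BN

theorem Family.ExpFamilyBounded.klBounded {X : Type*} [MeasurableSpace X] {Θ : Type*}
    [MeasurableSpace Θ] {m : ℕ} {ν : Measure X} {Gs : Set (DAG m)} {M : Family ν Θ Gs} {Δmax : ℝ}
    (hM : M.ExpFamilyBounded Δmax) : M.KLBounded Δmax := by
  obtain ⟨d, T, h, ψ, η, η₀, hT, hh, hp, hq, hTp, hTq, hle⟩ := hM
  intro G i θ
  refine le_trans (lintegral_mono fun x => ?_) (hle G i θ)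
  exact klDiv_expFamily_le hT hh (hp θ G i _) (hq θ i) (M.lintegral_dens θ G i _)
    (M.lintegral_dens₀ θ i) (hTp θ G i x) (hTq θ i)

/-! ### Counting layered DAGs -/

variable {m l : ℕ}

theorem layerSize_eq_card (lay : Fin m → Fin l) (j : ℕ) :
    layerSize lay j = (Finset.univ.filter fun v => (lay v : ℕ) = j).card := by
  rw [layerSize, ← Set.ncard_coe_finset]
  simp

theorem parents_eq_empty_of_mem_layeredDAGs {lay : Fin m → Fin l} {G : DAG m}
    (hG : G ∈ layeredDAGs lay) {v : Fin m} (hv : (lay v : ℕ) = l - 1) : G.parents v = ∅ := by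
  refine Set.eq_empty_of_forall_notMem fun u hu => ?_
  have h1 := hG u v hu
  have h2 := (lay u).2
  omega

theorem card_filter_lay_ne (lay : Fin m → Fin l) (j : ℕ) :
    ((Finset.univ.filter fun v => (lay v : ℕ) ≠ j).card : ℝ) = m - layerSize lay j := by
  have h := Finset.card_filter_add_card_filter_not (s := (Finset.univ : Finset (Fin m)))
    (fun v => (lay v : ℕ) = j)
  rw [Finset.card_univ, Fintype.card_fin, ← layerSize_eq_card] at h
  rw [eq_sub_iff_add_eq']
  exact_mod_cast h

theorem card_filter_lay_ne_pos {lay : Fin m → Fin l} (hl : 2 ≤ l)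
    (hlay : Function.Surjective lay) :
    0 < (Finset.univ.filter fun v => (lay v : ℕ) ≠ l - 1).card := by
  obtain ⟨v, hv⟩ := hlay ⟨0, by omega⟩
  refine Finset.card_pos.2 ⟨v, ?_⟩
  simp only [Finset.mem_filter, Finset.mem_univ, true_and, hv]
  omega

/-- The function `w` bounds the log-number of admissible parent sets in terms of the size of the
next layer, which serves the plain and the sparse ensemble alike. -/
theorem log_card_sparseLayeredDAGs (lay : Fin m → Fin l) (k : ℕ) (w : ℕ → ℝ)
    (hw : ∀ A : Finset (Fin m), w A.card ≤
      Real.log (A.powerset.filter fun S => S.card ≤ k).card) :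
    ∑ j ∈ Finset.range (l - 1), (layerSize lay j : ℝ) * w (layerSize lay (j + 1)) ≤
      Real.log (Fintype.card (sparseLayeredDAGs lay k)) := by
  set B : Fin m → ℕ := fun v =>
    ((Finset.univ.filter fun u => (lay u : ℕ) = lay v + 1).powerset.filter
      fun S => S.card ≤ k).card
  have hpos : ∀ v, 0 < B v := fun v => Finset.card_pos.2 ⟨∅, by simp⟩
  have h1 : (∏ v, (B v : ℝ)) ≤ Fintype.card (sparseLayeredDAGs lay k) := by
    exact_mod_cast prod_le_card_sparseLayeredDAGs lay k
  refine le_trans ?_ (Real.log_le_log (Finset.prod_pos fun v _ => by exact_mod_cast hpos v) h1)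
  rw [Real.log_prod fun v _ => by exact_mod_cast (hpos v).ne']
  set T := Finset.univ.filter fun v => (lay v : ℕ) ≠ l - 1
  -- Group the nodes outside the last layer by layer.
  have h2 : ∑ j ∈ Finset.range (l - 1), (layerSize lay j : ℝ) * w (layerSize lay (j + 1)) =
      ∑ v ∈ T, w (layerSize lay (lay v + 1)) := by
    rw [← Finset.sum_fiberwise_of_maps_to' (s := T) (t := Finset.range (l - 1))
      (g := fun v => (lay v : ℕ)) (fun v hv => ?_) fun j => w (layerSize lay (j + 1))]
    · refine Finset.sum_congr rfl fun j hj => ?_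
      rw [Finset.sum_const, nsmul_eq_mul, layerSize_eq_card, Finset.filter_filter]
      congr 3
      ext v
      have := Finset.mem_range.1 hj
      simp only [Finset.mem_filter, Finset.mem_univ, true_and]
      omega
    · have h3 := (lay v).2
      simp only [T, Finset.mem_filter, Finset.mem_univ, true_and] at hv
      rw [Finset.mem_range]
      omega
  rw [h2]
  refine (Finset.sum_le_sum fun v _ => ?_).trans (Finset.sum_le_sum_of_subset_of_nonneg
    (Finset.subset_univ T) fun v _ _ => Real.log_nonneg (by exact_mod_cast hpos v))
  rw [layerSize_eq_card]
  exact hw _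

theorem log_card_layeredDAGs (lay : Fin m → Fin l) :
    (∑ j ∈ Finset.range (l - 1), (layerSize lay (j + 1) : ℝ) * layerSize lay j) * Real.log 2 ≤
      Real.log (Fintype.card (layeredDAGs lay)) := by
  have h1 := log_card_sparseLayeredDAGs lay m (fun s => s * Real.log 2) fun A => by
    rw [Finset.filter_true_of_mem fun S _ => (Finset.card_le_univ S).trans_eq (Fintype.card_fin m),
      Finset.card_powerset]
    push_cast
    rw [Real.log_pow]
  have h2 : Fintype.card (sparseLayeredDAGs lay m) ≤ Fintype.card (layeredDAGs lay) :=
    Fintype.card_le_of_injective (fun G => ⟨G.1, G.2.1⟩) fun G H h => by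
      simpa [Subtype.ext_iff] using h
  have h3 : 0 < Fintype.card (sparseLayeredDAGs lay m) :=
    lt_of_lt_of_le (Finset.prod_pos fun v _ => Finset.card_pos.2 ⟨∅, by simp⟩)
      (prod_le_card_sparseLayeredDAGs lay m)
  refine le_trans (le_of_eq ?_) (h1.trans (Real.log_le_log (by exact_mod_cast h3)
    (by exact_mod_cast h2)))
  rw [Finset.sum_mul]
  exact Finset.sum_congr rfl fun j _ => by ring

/-- If `A` has fewer than `k` elements, the left side is at most 0 and the empty set makes the right
side nonnegative. -/
theorem mul_log_div_le_log_card_powerset_filter {α : Type*} (A : Finset α) (k : ℕ) :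
    k * Real.log ((A.card : ℝ) / k) ≤
      Real.log (A.powerset.filter fun S => S.card ≤ k).card := by
  rcases le_or_gt k A.card with hk | hk
  · refine (mul_log_div_le_log_choose hk).trans (Real.log_le_log ?_ ?_)
    · exact_mod_cast Nat.choose_pos hk
    · exact_mod_cast choose_le_card_powerset_filter A k
  · have h1 : Real.log ((A.card : ℝ) / k) ≤ 0 := by
      refine Real.log_nonpos (by positivity) (div_le_one_of_le₀ ?_ (by positivity))
      exact_mod_cast hk.le
    have h2 : 0 < (A.powerset.filter fun S => S.card ≤ k).card :=
      Finset.card_pos.2 ⟨∅, by simp⟩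
    exact (mul_nonpos_of_nonneg_of_nonpos (by positivity) h1).trans
      (Real.log_nonneg (by exact_mod_cast h2))

end BN

/-! ### The four ensembles -/

theorem theorem2 {X : Type*} [MeasurableSpace X] (ν : Measure X) [SigmaFinite ν]
    {Θ : Type*} [MeasurableSpace Θ] [Nonempty Θ]
    (m n : ℕ) (Δmax : ℝ) (hΔ : 0 < Δmax) :
    -- essential DAGs
    (∀ M : BN.Family ν Θ (BN.essentialDAGs m),
      M.KLBounded Δmax ∨ M.ExpFamilyBounded Δmax →
      (n : ℝ) ≤ BN.thresholdEssential m Δmax → 1 / 2 ≤ M.err n) ∧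
    -- sparse essential DAGs
    (∀ k : ℕ, 1 < k → k < m → ∀ M : BN.Family ν Θ (BN.sparseEssentialDAGs m k),
      M.KLBounded Δmax ∨ M.ExpFamilyBounded Δmax →
      (n : ℝ) ≤ BN.thresholdSparseEssential m k Δmax → 1 / 2 ≤ M.err n) ∧
    -- layered DAGs, with a known assignment of the nodes to at least two nonempty layers
    (∀ (l : ℕ) (lay : Fin m → Fin l), 2 ≤ l → Function.Surjective lay →
      ∀ M : BN.Family ν Θ (BN.layeredDAGs lay),
      M.KLBounded Δmax ∨ M.ExpFamilyBounded Δmax →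
      (n : ℝ) ≤ BN.thresholdLayered lay Δmax → 1 / 2 ≤ M.err n) ∧
    -- sparse layered DAGs
    (∀ (l : ℕ) (lay : Fin m → Fin l) (k : ℕ), 2 ≤ l → Function.Surjective lay → 1 ≤ k →
      ∀ M : BN.Family ν Θ (BN.sparseLayeredDAGs lay k),
      M.KLBounded Δmax ∨ M.ExpFamilyBounded Δmax →
      (n : ℝ) ≤ BN.thresholdSparseLayered lay k Δmax → 1 / 2 ≤ M.err n) := by
  have hn0 : (0 : ℝ) ≤ n := n.cast_nonneg
  have hlog2 := Real.log_pos one_lt_two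
  refine ⟨fun M hM hn => ?_, fun k hk hkm M hM hn => ?_, fun l lay hl hlay M hM hn => ?_,
    fun l lay k hl hlay hk M hM hn => ?_⟩
  · have hm : 1 ≤ m := by
      by_contra hm
      obtain rfl : m = 0 := by omega
      -- For `m = 0` the convention `1 / 0 = 0` makes the threshold negative, which no `n`
      -- satisfies.
      have h1 : 0 < Real.log 2 / (2 * Δmax) := by positivity
      simp only [BN.thresholdEssential, Nat.cast_zero, div_zero] at hn
      nlinarith
    have hm0 : (0 : ℝ) < m := by exact_mod_cast hm
    refine (hM.elim id fun h => h.klBounded).half_le_err hΔ.le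
      (fun G hG H _ h => h.eq_of_mem_essentialDAGs hG) (T := Finset.univ) (by simp) ?_
    have h1 := BN.log_card_essentialDAGs hm
    have h2 : BN.thresholdEssential m Δmax * (2 * m * Δmax) =
        Real.log 2 * (m * (m - 3) / 2 - 1) := by
      rw [BN.thresholdEssential]
      field_simp
    have h3 := mul_le_mul_of_nonneg_right hn (show 0 ≤ 2 * (m : ℝ) * Δmax by positivity)
    rw [h2] at h3
    rw [Finset.card_univ, Fintype.card_fin]
    -- The threshold is exact here: `(m - 1) * (m - 2) / 2 - 2 = m * (m - 3) / 2 - 1`, where the 2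
    -- is Fano's `2 * log 2`.
    nlinarith
  · have hm0 : (0 : ℝ) < m := by exact_mod_cast (by omega : 0 < m)
    refine (hM.elim id fun h => h.klBounded).half_le_err hΔ.le
      (fun G hG H _ h => h.eq_of_mem_essentialDAGs hG.1) (T := Finset.univ) (by simp) ?_
    have h1 := BN.log_card_sparseEssentialDAGs hk hkm
    rw [BN.thresholdSparseEssential, one_div, inv_mul_eq_div, le_div_iff₀ (by positivity)] at hn
    rw [Finset.card_univ, Fintype.card_fin]
    linarith
  · have hT := BN.card_filter_lay_ne_pos hl hlay
    have hT0 : (0 : ℝ) < (m : ℝ) - BN.layerSize lay (l - 1) := by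
      rw [← BN.card_filter_lay_ne]
      exact_mod_cast hT
    refine (hM.elim id fun h => h.klBounded).half_le_err hΔ.le
      (fun G hG H hH h => h.eq_of_mem_layeredDAGs hG hH)
      (T := Finset.univ.filter fun v => (lay v : ℕ) ≠ l - 1)
      (fun G hG i hi => BN.parents_eq_empty_of_mem_layeredDAGs hG (by simpa using hi)) ?_
    have h1 := BN.log_card_layeredDAGs lay
    rw [BN.thresholdLayered, div_mul_eq_mul_div, le_div_iff₀ (by positivity)] at hn
    rw [BN.card_filter_lay_ne]
    linarith
  · have hT := BN.card_filter_lay_ne_pos hl hlay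
    have hT0 : (0 : ℝ) < (m : ℝ) - BN.layerSize lay (l - 1) := by
      rw [← BN.card_filter_lay_ne]
      exact_mod_cast hT
    refine (hM.elim id fun h => h.klBounded).half_le_err hΔ.le
      (fun G hG H hH h => h.eq_of_mem_layeredDAGs hG.1 hH.1)
      (T := Finset.univ.filter fun v => (lay v : ℕ) ≠ l - 1)
      (fun G hG i hi => BN.parents_eq_empty_of_mem_layeredDAGs hG.1 (by simpa using hi)) ?_
    have h1 := BN.log_card_sparseLayeredDAGs lay k (fun s => k * Real.log ((s : ℝ) / k))
      fun A => BN.mul_log_div_le_log_card_powerset_filter A k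
    rw [BN.thresholdSparseLayered, le_div_iff₀ (by positivity)] at hn
    rw [BN.card_filter_lay_ne]
    have h2 : ∑ j ∈ Finset.range (l - 1), (BN.layerSize lay j : ℝ) *
        (k * Real.log ((BN.layerSize lay (j + 1) : ℝ) / k)) =
        k * ∑ j ∈ Finset.range (l - 1), (BN.layerSize lay j : ℝ) *
          Real.log ((BN.layerSize lay (j + 1) : ℝ) / k) := by
      rw [Finset.mul_sum]
      exact Finset.sum_congr rfl fun j _ => by ring
    rw [h2] at h1
    linarith
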